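/- Graphs are finite and may have loops and parallel edges. A graph is connected if it has at least one vertex and any two of its vertices are joined by a walk. A graph is $k$-edge-connected if it remains connected after the deletion of any set of fewer than $k$ edges; in particular, every graph with exactly one vertex (and any number of loops) is $k$-edge-connected. In an oriented graph $G=(V,E)$, let $\delta^+(v)$ and $\delta^-(v)$ denote the sets of edges with initial, respectively terminal, vertex $v$. For an additive abelian group $\Gamma$, a $\Gamma$-flow is a function $\phi:E\to\Gamma$ with $\sum_{e\in\delta^+(v)}\phi(e)=\sum_{e\in\delta^-(v)}\phi(e)$ for every $v\in V$; it is nowhere-zero if $\phi(e)\neq 0$ for every $e\in E$. Theorem. Let $G$ be an oriented graph with $n$ vertices and $m$ edges. (1) If $G$ is $3$-edge-connected, then $G$ has at least $2^{(m-n)/3}$ nowhere-zero $\mathbb{Z}_6$-flows. Moreover, if $G$ is $2$-edge-connected, then $G$ has at least $2^{(m-n)/3}$ nowhere-zero $\mathbb{Z}_2\times\mathbb{Z}_3$-flows. (2) If $G$ is $4$-edge-connected and has at least one edge (which is automatic when $n\ge 2$), then $G$ has at least $2^{n/3}$ nowhere-zero $\mathbb{Z}_2\times\mathbb{Z}_2$-flows.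 -/

import Mathlib

/-- `G` is connected: it has a vertex, and any two of its vertices are joined by a walk
(a finite chain of adjacencies). -/
def Graph.IsConnected {α β : Type*} (G : Graph α β) : Prop :=
  G.vertexSet.Nonempty ∧
    ∀ x ∈ G.vertexSet, ∀ y ∈ G.vertexSet, Relation.ReflTransGen G.Adj x y

/-- `G` is `k`-edge-connected: deleting fewer than `k` edges always leaves a connected graph.
(So a graph with a single vertex, possibly with loops, is `k`-edge-connected for every `k`.) -/
def Graph.IsEdgeConnected {α β : Type*} (G : Graph α β) (k : ℕ) : Prop :=
  ∀ F : Set β, F ⊆ G.edgeSet → F.encard < k → (G.deleteEdges F).IsConnected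

/-- An orientation of a multigraph: every edge gets an initial vertex `src` and a terminal
vertex `tgt`, which are the two ends of the edge (equal exactly for loops). -/
structure Graph.Orientation {α β : Type*} (G : Graph α β) where
  src : G.edgeSet → α
  tgt : G.edgeSet → α
  isLink : ∀ e : G.edgeSet, G.IsLink e (src e) (tgt e)

open Classical in
/-- `φ : E(G) → Γ` is a `Γ`-flow with respect to the orientation `D`: at every vertex the sum
over the outgoing edges equals the sum over the incoming edges. -/
def Graph.Orientation.IsFlow {α β : Type*} {G : Graph α β} [Fintype G.edgeSet]
    (D : G.Orientation) {Γ : Type*} [AddCommGroup Γ] (φ : G.edgeSet → Γ) : Prop :=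
  ∀ v ∈ G.vertexSet,
    ∑ e : G.edgeSet with D.src e = v, φ e = ∑ e : G.edgeSet with D.tgt e = v, φ e

/-- The set of nowhere-zero `Γ`-flows of the oriented graph `(G, D)`. -/
def Graph.Orientation.nowhereZeroFlows {α β : Type*} {G : Graph α β} [Fintype G.edgeSet]
    (D : G.Orientation) (Γ : Type*) [AddCommGroup Γ] : Set (G.edgeSet → Γ) :=
  {φ | D.IsFlow φ ∧ ∀ e, φ e ≠ 0}

/-!
The number of nowhere-zero flows is bounded below by starting from one nowhere-zero flow and adding
even subgraphs to it. The basic count is `card_flowsOn`: on `n` vertices, at least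
`|Γ| ^ (|T| - n + 1)` flows with values in `Γ` are supported in a given set `T` of edges.

*Flows over `ℤ₂ × ℤ₂`.* Let `φ` be nowhere-zero and let `c` be a nonzero element of the group. On
the edges where `φ` differs from `c` one may add multiples of `c` without creating zeros. The three
sets of this kind cover every edge twice, so one of them has at least `2 m / 3` edges, and a
4-edge-connected graph has `m ≥ 2 n` if `n ≥ 2`; this gives `2 ^ (n / 3)` flows
(`EdgeConn.four_le_ncard_nzFlows`). A first flow comes from two edge-disjoint connected spanning
subgraphs: each coordinate is set to one off one of the subgraphs and completed on it. The
subgraphs are found by contracting a minimal set of vertices that spans enough edges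
(`EdgeConn.packs`); the graph on that set decomposes into two spanning trees by induction,
contracting subgraphs attaining the sparsity bound and splitting at vertices of degree three
(`packs_of_tight`).

*Flows over `ℤ₂ × ℤ₃`.* Contracting an edge of a 2-edge-cut preserves `m - n` and does not
increase the number of nowhere-zero flows (`ncard_nzFlows_contract_le`), so the graph may be taken
3-edge-connected. Seymour's argument (`exists_seymour_pair`) gives a disjoint union `S` of closed
trails and a `ℤ₃`-flow `φ` nonzero off `S`: a block of the graph minus a root contains a closed
trail through the ends of two edges to the root (`exists_leaf_block`, `exists_closed_trail`), the
trail and the root are contracted, and the values on the two edges are adjusted afterwards. Now add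
to `φ` an arbitrary `ℤ₃`-flow `ψ` supported in `S`, and to the indicator of `S` an arbitrary even
subgraph of the support of `φ + ψ`. Each edge of `S` is a zero of a third of the flows `φ + ψ`, so
by convexity there are at least `max (1, 3 ^ (|S| - n + 1)) * 2 ^ (m - |S| / 3 - n + 1)` pairs. As
`2 m ≥ 3 n` if `n ≥ 2`, this is at least `2 ^ ((m - n) / 3)` for every size of `S`
(`EdgeConn.three_le_ncard_nzFlows`). The groups `ℤ₆` and `ℤ₂ × ℤ₃` are isomorphic, which covers the
remaining case.
-/

namespace FlowCount

open Finset
open scoped Classical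

section Basic

variable {V E Γ Γ' : Type*} [AddCommGroup Γ] [AddCommGroup Γ']

/-! ### Cuts, boundaries and contraction -/

/-- The edges of `F` with exactly one end in `X`. The maps `s` and `t` give the initial and the
terminal vertex of an edge. -/
noncomputable def cut (F : Finset E) (s t : E → V) (X : Set V) : Finset E :=
  F.filter fun e => ¬ (s e ∈ X ↔ t e ∈ X)

/-- All edges of `F` have both ends in `A`, so that `(A, F)` is a graph. -/
def HasEnds (A : Finset V) (F : Finset E) (s t : E → V) : Prop :=
  ∀ e ∈ F, s e ∈ A ∧ t e ∈ A

/-- Edge-connectivity of the graph `(A, F)` in terms of cuts: every set of vertices that splits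
`A` is left by at least `k` edges of `F`. The set need not be contained in `A`, which makes the
notion stable under pulling back along a map of vertices. -/
def EdgeConn (k : ℕ) (A : Finset V) (F : Finset E) (s t : E → V) : Prop :=
  ∀ X : Set V, (∃ a ∈ A, a ∈ X) → (∃ b ∈ A, b ∉ X) → k ≤ (cut F s t X).card

lemma EdgeConn.mono {k l : ℕ} (h : l ≤ k) {A : Finset V} {F F' : Finset E} {s t : E → V}
    (hF : F ⊆ F') (hc : EdgeConn k A F s t) : EdgeConn l A F' s t := fun X ha hb =>
  (h.trans (hc X ha hb)).trans (card_le_card (filter_subset_filter _ hF))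

/-- Contraction does not lower edge-connectivity. -/
lemma EdgeConn.image {k : ℕ} {A : Finset V} {F : Finset E} {s t : E → V}
    (hc : EdgeConn k A F s t) (r : V → V) : EdgeConn k (A.image r) F (r ∘ s) (r ∘ t) := by
  rintro X ⟨a, ha, haX⟩ ⟨b, hb, hbX⟩
  obtain ⟨a', ha', rfl⟩ := mem_image.1 ha
  obtain ⟨b', hb', rfl⟩ := mem_image.1 hb
  exact hc (r ⁻¹' X) ⟨a', ha', haX⟩ ⟨b', hb', hbX⟩

lemma HasEnds.image {A : Finset V} {F : Finset E} {s t : E → V} (h : HasEnds A F s t)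
    (r : V → V) : HasEnds (A.image r) F (r ∘ s) (r ∘ t) := fun e he =>
  ⟨mem_image_of_mem r (h e he).1, mem_image_of_mem r (h e he).2⟩

lemma exists_mem_cut {F : Finset E} {s t : E → V} {A : Finset V} (hc : EdgeConn 1 A F s t)
    {X : Set V} (ha : ∃ a ∈ A, a ∈ X) (hb : ∃ b ∈ A, b ∉ X) :
    ∃ e ∈ F, ¬ (s e ∈ X ↔ t e ∈ X) := by
  obtain ⟨e, he⟩ := Finset.card_pos.1 (hc X ha hb)
  exact ⟨e, (mem_filter.1 he).1, (mem_filter.1 he).2⟩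

variable [Fintype E]

/-- The boundary of a function on the edges: outflow minus inflow. -/
noncomputable def bdry (s t : E → V) : (E → Γ) →+ (V → Γ) where
  toFun φ v := ∑ e, ((if s e = v then φ e else 0) - (if t e = v then φ e else 0))
  map_zero' := by ext v; simp
  map_add' φ ψ := by
    ext v
    simp only [Pi.add_apply, ← Finset.sum_add_distrib]
    refine Finset.sum_congr rfl fun e _ => ?_
    split_ifs <;> abel

lemma bdry_apply (s t : E → V) (φ : E → Γ) (v : V) :
    bdry s t φ v = ∑ e, ((if s e = v then φ e else 0) - (if t e = v then φ e else 0)) := rfl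

lemma sum_bdry (s t : E → V) (φ : E → Γ) (X : Finset V) :
    ∑ v ∈ X, bdry s t φ v
      = ∑ e, ((if s e ∈ X then φ e else 0) - (if t e ∈ X then φ e else 0)) := by
  simp only [bdry_apply]
  rw [Finset.sum_comm]
  refine Finset.sum_congr rfl fun e _ => ?_
  rw [Finset.sum_sub_distrib]
  simp

lemma sum_bdry_eq_zero {s t : E → V} {φ : E → Γ} {A : Finset V} {F : Finset E}
    (hF : HasEnds A F s t) (hφ : ∀ e, e ∉ F → φ e = 0) : ∑ v ∈ A, bdry s t φ v = 0 := by
  rw [sum_bdry]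
  refine Finset.sum_eq_zero fun e _ => ?_
  by_cases he : e ∈ F
  · simp [hF e he]
  · simp [hφ e he]

lemma bdry_eq_zero_of_notMem {s t : E → V} {φ : E → Γ} {A : Finset V} {F : Finset E}
    (hF : HasEnds A F s t) (hφ : ∀ e, e ∉ F → φ e = 0) {v : V} (hv : v ∉ A) :
    bdry s t φ v = 0 := by
  rw [bdry_apply]
  refine Finset.sum_eq_zero fun e _ => ?_
  by_cases he : e ∈ F
  · rw [if_neg, if_neg, sub_zero]
    · rintro rfl; exact hv (hF e he).2
    · rintro rfl; exact hv (hF e he).1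
  · simp [hφ e he]

lemma bdry_map (s t : E → V) (f : Γ →+ Γ') (φ : E → Γ) (v : V) :
    bdry s t (fun e => f (φ e)) v = f (bdry s t φ v) := by
  simp only [bdry_apply, map_sum, map_sub]
  refine Finset.sum_congr rfl fun e _ => ?_
  split_ifs <;> simp

lemma bdry_single (s t : E → V) (e : E) (γ : Γ) :
    bdry s t (Pi.single e γ) = Pi.single (s e) γ - Pi.single (t e) γ := by
  ext v
  rw [bdry_apply, Finset.sum_eq_single e]
  · simp [Pi.single_apply, eq_comm]
  · intro f _ hf; simp [hf]
  · simp

/-- The boundary in a contracted graph is the sum of the boundaries over each fibre. -/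
lemma bdry_comp (r : V → V) (s t : E → V) (φ : E → Γ) (w : V) (X : Finset V)
    (hs : ∀ e, φ e ≠ 0 → (r (s e) = w ↔ s e ∈ X)) (ht : ∀ e, φ e ≠ 0 → (r (t e) = w ↔ t e ∈ X)) :
    bdry (r ∘ s) (r ∘ t) φ w = ∑ v ∈ X, bdry s t φ v := by
  rw [sum_bdry, bdry_apply]
  refine Finset.sum_congr rfl fun e _ => ?_
  by_cases he : φ e = 0
  · simp [he]
  · simp [hs e he, ht e he]

/-- If integral unit flows within `C` run from `x` to all vertices of `B`, then every
function on `B` with sum zero is the boundary of a function supported in `C`. -/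
lemma exists_bdry_eq_of_paths {s t : E → V} {C : Finset E} {B : Finset V} {x : V}
    (h : ∀ z ∈ B, ∃ σ : E → ℤ, (∀ e, e ∉ C → σ e = 0) ∧
      bdry s t σ = Pi.single x 1 - Pi.single z 1)
    (b : V → Γ) (hb : ∀ v, v ∉ B → b v = 0) (hsum : ∑ v ∈ B, b v = 0) :
    ∃ φ : E → Γ, (∀ e, e ∉ C → φ e = 0) ∧ bdry s t φ = b := by
  choose! σ hσ0 hσ using h
  refine ⟨∑ z ∈ B, fun e => -(σ z e • b z), fun e he => ?_, ?_⟩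
  · rw [Finset.sum_apply]
    exact Finset.sum_eq_zero fun z hz => by simp [hσ0 z hz e he]
  · rw [map_sum]
    ext v
    have key : ∀ z ∈ B, bdry s t (fun e => -(σ z e • b z)) v
        = (if v = z then b z else 0) - (if v = x then b z else 0) := by
      intro z hz
      have := bdry_map s t (-(zmultiplesHom Γ (b z))) (σ z) v
      simp only [AddMonoidHom.neg_apply, zmultiplesHom_apply] at this
      rw [this, hσ z hz]
      simp only [Pi.sub_apply, Pi.single_apply]
      split_ifs <;> simp
    rw [Finset.sum_apply, Finset.sum_congr rfl key, Finset.sum_sub_distrib]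
    have h1 : ∑ z ∈ B, (if v = x then b z else 0) = 0 := by
      split_ifs
      · exact hsum
      · simp
    rw [h1, sub_zero, Finset.sum_ite_eq]
    split_ifs with hv
    · rfl
    · exact (hb v hv).symm

/-- In a connected graph every function with sum zero is a boundary. -/
lemma EdgeConn.exists_bdry_eq {s t : E → V} {C : Finset E} {A : Finset V}
    (hc : EdgeConn 1 A C s t) (b : V → Γ) (hb : ∀ v, v ∉ A → b v = 0)
    (hsum : ∑ v ∈ A, b v = 0) :
    ∃ φ : E → Γ, (∀ e, e ∉ C → φ e = 0) ∧ bdry s t φ = b := by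
  obtain rfl | ⟨x, hx⟩ := A.eq_empty_or_nonempty
  · exact ⟨0, by simp, by ext v; simp [hb v]⟩
  refine exists_bdry_eq_of_paths (x := x) (fun z hz => ?_) b hb hsum
  let X : Set V := {z | ∃ σ : E → ℤ, (∀ e, e ∉ C → σ e = 0) ∧
      bdry s t σ = Pi.single x 1 - Pi.single z 1}
  by_contra hzX
  obtain ⟨e, heC, he⟩ := exists_mem_cut (X := X) hc ⟨x, hx, 0, by simp, by simp⟩ ⟨z, hz, hzX⟩
  apply he
  constructor
  · rintro ⟨σ, h0, hσ⟩
    refine ⟨σ + Pi.single e 1, fun f hf => ?_, ?_⟩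
    · have : f ≠ e := by rintro rfl; exact hf heC
      simp [h0 f hf, this]
    · rw [map_add, hσ, bdry_single]; abel
  · rintro ⟨σ, h0, hσ⟩
    refine ⟨σ - Pi.single e 1, fun f hf => ?_, ?_⟩
    · have : f ≠ e := by rintro rfl; exact hf heC
      simp [h0 f hf, this]
    · rw [map_sub, hσ, bdry_single]; abel

end Basic

section Trail

variable {V E : Type*}

/-! ### Closed trails through two vertices -/

/-- The edge `e` has ends `a` and `b`, in either direction. -/
def Joins (s t : E → V) (e : E) (a b : V) : Prop :=
  (s e = a ∧ t e = b) ∨ (s e = b ∧ t e = a)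

lemma Joins.symm {s t : E → V} {e : E} {a b : V} (h : Joins s t e a b) : Joins s t e b a :=
  Or.symm h

/-- `IsTrail s t a b C`: the set `C` is the edge set of a trail (a walk without repeated edges)
from `a` to `b`, where edges may be traversed in either direction. -/
inductive IsTrail (s t : E → V) : V → V → Finset E → Prop
  | nil (a : V) : IsTrail s t a a ∅
  | cons {a b c : V} {e : E} {C : Finset E} (he : Joins s t e a b) (heC : e ∉ C)
      (h : IsTrail s t b c C) : IsTrail s t a c (insert e C)

/-- The vertex `z` lies on a trail that starts at `a` and has edge set `C`. -/
def OnTrail (s t : E → V) (a : V) (C : Finset E) (z : V) : Prop :=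
  z = a ∨ ∃ e ∈ C, s e = z ∨ t e = z

lemma IsTrail.single {s t : E → V} {a b : V} {e : E} (he : Joins s t e a b) :
    IsTrail s t a b {e} :=
  IsTrail.cons he (notMem_empty e) (IsTrail.nil b)

lemma IsTrail.append {s t : E → V} {a b c : V} {C D : Finset E} (h : IsTrail s t a b C)
    (h' : IsTrail s t b c D) (hCD : Disjoint C D) : IsTrail s t a c (C ∪ D) := by
  induction h with
  | nil => simpa using h'
  | @cons a b c e C he heC _ ih =>
    rw [disjoint_insert_left] at hCD
    rw [insert_union]
    exact IsTrail.cons he (by simp [heC, hCD.1]) (ih h' hCD.2)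

lemma IsTrail.reverse {s t : E → V} {a b : V} {C : Finset E} (h : IsTrail s t a b C) :
    IsTrail s t b a C := by
  induction h with
  | nil a => exact IsTrail.nil a
  | @cons a b c e C he heC _ ih =>
    have := ih.append (IsTrail.single he.symm) (by simpa using heC)
    rwa [union_comm, ← insert_eq] at this

lemma OnTrail.trans {s t : E → V} {a b : V} {C : Finset E} {e : E} (he : Joins s t e a b)
    {z : V} (h : OnTrail s t a (insert e C) z) : z = a ∨ OnTrail s t b C z := by
  obtain h | ⟨f, hf, hz⟩ := h
  · exact Or.inl h
  obtain rfl | hf := mem_insert.1 hf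
  · unfold Joins at he
    unfold OnTrail
    grind
  · exact Or.inr (Or.inr ⟨f, hf, hz⟩)

/-- A trail can be cut in two at any of its vertices. -/
lemma IsTrail.split {s t : E → V} {a b z : V} {C : Finset E} (h : IsTrail s t a b C)
    (hz : OnTrail s t a C z) : ∃ C₁ C₂, Disjoint C₁ C₂ ∧ C = C₁ ∪ C₂ ∧
      IsTrail s t a z C₁ ∧ IsTrail s t z b C₂ := by
  induction h with
  | nil a =>
    obtain rfl | ⟨e, he, _⟩ := hz
    · exact ⟨∅, ∅, by simp, by simp, IsTrail.nil _, IsTrail.nil _⟩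
    · simp at he
  | @cons a b c e C he heC hC ih =>
    obtain rfl | hz := hz.trans he
    · exact ⟨∅, insert e C, by simp, by simp, IsTrail.nil _, IsTrail.cons he heC hC⟩
    · obtain ⟨C₁, C₂, hd, rfl, h1, h2⟩ := ih hz
      rw [mem_union, not_or] at heC
      exact ⟨insert e C₁, C₂, by simp [hd, heC.2], by rw [insert_union],
        IsTrail.cons he heC.1 h1, h2⟩

/-- Sending one unit along a trail gives an integral flow. -/
lemma IsTrail.exists_flow [Fintype E] {s t : E → V} {a b : V} {C : Finset E}
    (h : IsTrail s t a b C) : ∃ σ : E → ℤ, (∀ e ∈ C, σ e = 1 ∨ σ e = -1) ∧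
      (∀ e, e ∉ C → σ e = 0) ∧ bdry s t σ = Pi.single a 1 - Pi.single b 1 := by
  induction h with
  | nil a => exact ⟨0, by simp, by simp, by simp⟩
  | @cons a b c e C he heC hC ih =>
    obtain ⟨σ, h1, h0, hσ⟩ := ih
    obtain ⟨ε, hε, hb⟩ : ∃ ε : ℤ, (ε = 1 ∨ ε = -1) ∧
        bdry s t (Pi.single e ε) = Pi.single a 1 - Pi.single b 1 := by
      obtain ⟨rfl, rfl⟩ | ⟨rfl, rfl⟩ := he
      · exact ⟨1, by simp, bdry_single s t e 1⟩
      · refine ⟨-1, by simp, ?_⟩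
        rw [bdry_single, Pi.single_neg, Pi.single_neg]; abel
    refine ⟨σ + Pi.single e ε, fun f hf => ?_, fun f hf => ?_, ?_⟩
    · obtain rfl | hfC := mem_insert.1 hf
      · simpa [h0 _ heC] using hε
      · have : f ≠ e := by rintro rfl; exact heC hfC
        simpa [this] using h1 f hfC
    · rw [mem_insert, not_or] at hf
      simp [hf.1, h0 f hf.2]
    · rw [map_add, hσ, hb]; abel

/-- Starting from `w` one can reach a given trail by a trail that is edge-disjoint from it and
avoids a prescribed edge `e`. -/
lemma exists_trail_to {s t : E → V} {B : Finset V} {F C : Finset E}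
    (hc : EdgeConn 2 B F s t) {x w : V} (hx : x ∈ B) (hw : w ∈ B) (e : E) :
    ∃ z D, OnTrail s t x C z ∧ IsTrail s t w z D ∧ D ⊆ F ∧ e ∉ D ∧ Disjoint C D := by
  by_contra! hcon
  let Y : Set V := {v | ∃ D, IsTrail s t w v D ∧ D ⊆ F ∧ e ∉ D ∧ Disjoint C D}
  have hxY : x ∉ Y := by
    rintro ⟨D, h1, h2, h3, h4⟩
    exact hcon x D (Or.inl rfl) h1 h2 h3 h4
  have hcut := hc Y ⟨w, hw, ∅, IsTrail.nil w, by simp, by simp, by simp⟩ ⟨x, hx, hxY⟩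
  obtain ⟨f, hf, hfe⟩ := Finset.exists_mem_ne hcut e
  obtain ⟨hfF, hf⟩ := mem_filter.1 hf
  obtain ⟨v, v', hj, ⟨D, h1, h2, h3, h4⟩, hv'⟩ : ∃ v v', Joins s t f v v' ∧ v ∈ Y ∧ v' ∉ Y := by
    unfold Joins
    by_cases h : s f ∈ Y
    · exact ⟨s f, t f, by simp, h, fun h' => hf ⟨fun _ => h', fun _ => h⟩⟩
    · exact ⟨t f, s f, by simp, by tauto, h⟩
  have hfC : f ∉ C := fun hfC => hcon v D (Or.inr ⟨f, hfC, by unfold Joins at hj; tauto⟩)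
    h1 h2 h3 h4
  apply hv'
  by_cases hfD : f ∈ D
  · obtain ⟨D₁, D₂, _, rfl, h5, _⟩ := h1.split (z := v')
      (Or.inr ⟨f, hfD, by unfold Joins at hj; tauto⟩)
    exact ⟨D₁, h5, subset_union_left.trans h2, fun h => h3 (mem_union_left _ h),
      h4.mono_right subset_union_left⟩
  · refine ⟨D ∪ {f}, h1.append (IsTrail.single hj) (by simpa using hfD), ?_, ?_, ?_⟩
    · exact union_subset h2 (by simpa using hfF)
    · simp [h3, hfe.symm]
    · simp [h4, hfC]

/-- In a 2-edge-connected graph any two vertices lie on a common closed trail (the edge version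
of Menger's theorem for two paths). -/
theorem exists_closed_trail {s t : E → V} {B : Finset V} {F : Finset E} (hF : HasEnds B F s t)
    (hc : EdgeConn 2 B F s t) {x y : V} (hx : x ∈ B) (hy : y ∈ B) :
    ∃ C ⊆ F, IsTrail s t x x C ∧ OnTrail s t x C y := by
  let P : Set V := {v | ∃ C ⊆ F, IsTrail s t x x C ∧ OnTrail s t x C v}
  by_contra hyP
  have hyP : y ∉ P := hyP
  obtain ⟨e, heF, he⟩ := exists_mem_cut (hc.mono one_le_two subset_rfl)
    ⟨x, hx, show x ∈ P from ⟨∅, by simp, IsTrail.nil x, Or.inl rfl⟩⟩ ⟨y, hy, hyP⟩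
  obtain ⟨v, w, hj, ⟨C, hCF, hC, hv⟩, hw⟩ : ∃ v w, Joins s t e v w ∧ v ∈ P ∧ w ∉ P := by
    unfold Joins
    by_cases h : s e ∈ P
    · exact ⟨s e, t e, by simp, h, fun h' => he ⟨fun _ => h', fun _ => h⟩⟩
    · exact ⟨t e, s e, by simp, by tauto, h⟩
  apply hw
  have hwe : s e = w ∨ t e = w := by unfold Joins at hj; tauto
  have hwB : w ∈ B := by
    obtain rfl | rfl := hwe
    exacts [(hF e heF).1, (hF e heF).2]
  have heC : e ∉ C := fun h => hw ⟨C, hCF, hC, Or.inr ⟨e, h, hwe⟩⟩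
  obtain ⟨z, D, hz, hD, hDF, heD, hCD⟩ := exists_trail_to (C := C) hc hx hwB e
  obtain ⟨C₁, C₂, h12, rfl, hC₁, hC₂⟩ := hC.split hv
  rw [mem_union, not_or] at heC
  obtain ⟨h1D, h2D⟩ := disjoint_union_left.1 hCD
  have heF' : ({e} : Finset E) ⊆ F := by simpa using heF
  have hC₁F := (union_subset_iff.1 hCF).1
  have hC₂F := (union_subset_iff.1 hCF).2
  -- The detour `v, w, z` replaces the part of the closed trail between `v` and `z`.
  have hz' : OnTrail s t x C₁ z ∨ OnTrail s t v C₂ z := by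
    obtain h | ⟨f, hf, h⟩ := hz
    · exact Or.inl (Or.inl h)
    obtain hf | hf := mem_union.1 hf
    exacts [Or.inl (Or.inr ⟨f, hf, h⟩), Or.inr (Or.inr ⟨f, hf, h⟩)]
  obtain hz' | hz' := hz'
  · obtain ⟨Ca, Cb, hab, rfl, ha, hb⟩ := hC₁.split hz'
    refine ⟨((Ca ∪ D) ∪ {e}) ∪ C₂, ?_, ((ha.append hD.reverse ?_).append
      (IsTrail.single hj.symm) ?_).append hC₂ ?_, Or.inr ⟨e, by simp, hwe⟩⟩
    · grind
    all_goals
      rw [disjoint_left] at *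
      grind
  · obtain ⟨Ca, Cb, hab, rfl, ha, hb⟩ := hC₂.split hz'
    refine ⟨((C₁ ∪ {e}) ∪ D) ∪ Cb, ?_, ((hC₁.append (IsTrail.single hj) ?_).append hD ?_).append
      hb ?_, Or.inr ⟨e, by simp, hwe⟩⟩
    · grind
    all_goals
      rw [disjoint_left] at *
      grind

end Trail

section Seymour

variable {V E : Type*}

/-! ### Seymour's decomposition of 3-edge-connected graphs -/

/-- In a 3-edge-connected graph with root `u`, a minimal set `B` avoiding `u` that is left by at
most one edge avoiding `u` induces a 2-edge-connected graph, and sends two edges to `u`. -/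
lemma exists_leaf_block {s t : E → V} {A : Finset V} {F : Finset E} {u : V}
    (hF : HasEnds A F s t) (hc : EdgeConn 3 A F s t) (hu : u ∈ A) (hA : A ≠ {u}) :
    ∃ B : Finset V, B ⊆ A ∧ u ∉ B ∧
      EdgeConn 2 B (F.filter fun e => s e ∈ B ∧ t e ∈ B) s t ∧
      ∃ e₁ ∈ F, ∃ e₂ ∈ F, e₁ ≠ e₂ ∧ ∃ x ∈ B, ∃ y ∈ B, Joins s t e₁ x u ∧ Joins s t e₂ y u := by
  let D : Finset V → Finset E := fun B =>
    F.filter fun e => ¬ (s e ∈ B ↔ t e ∈ B) ∧ s e ≠ u ∧ t e ≠ u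
  let good : Finset (Finset V) := A.powerset.filter fun B =>
    B.Nonempty ∧ u ∉ B ∧ (D B).card ≤ 1
  have hne : good.Nonempty := by
    refine ⟨A.erase u, mem_filter.2 ⟨mem_powerset.2 (erase_subset _ _), ?_, by simp, ?_⟩⟩
    · by_contra h
      rw [not_nonempty_iff_eq_empty, erase_eq_empty_iff] at h
      obtain rfl | h := h
      · simp at hu
      · exact hA h
    · have : D (A.erase u) = ∅ := by
        refine filter_eq_empty_iff.2 fun e he h => ?_
        have := hF e he
        simp [h.2.1, h.2.2, this] at h
      simp [this]
  obtain ⟨B, hB, hmin⟩ := exists_min_image good card hne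
  obtain ⟨hBA, hBne, huB, hDB⟩ : B ⊆ A ∧ B.Nonempty ∧ u ∉ B ∧ (D B).card ≤ 1 := by
    simpa [good] using hB
  have hbig : ∀ X ⊆ B, X ≠ B → X.Nonempty → 2 ≤ (D X).card := by
    intro X hXB hne' hXne
    by_contra hlt
    have hX : X ∈ good := by
      simp only [good, mem_filter, mem_powerset]
      exact ⟨hXB.trans hBA, hXne, fun h => huB (hXB h), by omega⟩
    exact absurd (hmin X hX) (not_le.2 (card_lt_card (hXB.ssubset_of_ne hne')))
  refine ⟨B, hBA, huB, ?_, ?_⟩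
  · rintro X ⟨a, haB, haX⟩ ⟨b, hbB, hbX⟩
    have h1 := hbig (B.filter (· ∈ X)) (filter_subset _ _)
      (fun h => hbX (filter_eq_self.1 h b hbB)) ⟨a, by simp [haB, haX]⟩
    have h2 := hbig (B.filter (· ∉ X)) (filter_subset _ _)
      (fun h => filter_eq_self.1 h a haB haX) ⟨b, by simp [hbB, hbX]⟩
    -- An edge leaving one of the two parts goes to the other part or leaves `B`.
    have h3 : (D (B.filter (· ∈ X))).card + (D (B.filter (· ∉ X))).card ≤
        2 * (cut (F.filter fun e => s e ∈ B ∧ t e ∈ B) s t X).card + (D B).card := by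
      simp only [D, cut, filter_filter, card_filter, mul_sum, ← sum_add_distrib, mem_filter]
      refine sum_le_sum fun e _ => ?_
      by_cases p1 : s e ∈ B <;> by_cases p2 : t e ∈ B <;> by_cases p3 : s e ∈ X <;>
        by_cases p4 : t e ∈ X <;> by_cases p5 : s e = u <;> by_cases p6 : t e = u <;>
        simp [p1, p2, p3, p4, p5, p6]
    omega
  · have h3 := hc (↑B) (by obtain ⟨b, hb⟩ := hBne; exact ⟨b, hBA hb, hb⟩) ⟨u, hu, huB⟩
    have h4 : (cut F s t ↑B \ D B).card ≥ 2 := by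
      have := le_card_sdiff (D B) (cut F s t ↑B)
      omega
    have hj : ∀ e ∈ cut F s t ↑B \ D B, e ∈ F ∧ ∃ x ∈ B, Joins s t e x u := by
      intro e he
      simp only [cut, D, mem_sdiff, mem_filter, mem_coe] at he
      refine ⟨he.1.1, ?_⟩
      unfold Joins
      grind
    obtain ⟨e₁, h₁, e₂, h₂, hne⟩ := one_lt_card.1 h4
    obtain ⟨h₁F, x, hx, h₁⟩ := hj e₁ h₁
    obtain ⟨h₂F, y, hy, h₂⟩ := hj e₂ h₂
    exact ⟨e₁, h₁F, e₂, h₂F, hne, x, hx, y, hy, h₁, h₂⟩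

/-- Two nonzero values can be chosen on two edges of a cut so as to balance it modulo 3. -/
lemma zmod_three_balance (c p₁ p₂ ε₁ ε₂ : ZMod 3) (h₁ : ε₁ = 1 ∨ ε₁ = -1)
    (h₂ : ε₂ = 1 ∨ ε₂ = -1) :
    ∃ a₁ a₂ : ZMod 3, p₁ + a₁ ≠ 0 ∧ p₂ + a₂ ≠ 0 ∧ c + ε₁ * a₁ + ε₂ * a₂ = 0 := by
  revert c p₁ p₂ ε₁ ε₂
  decide

variable [Fintype E]

/-- A 3-edge-connected graph has a `ℤ₃`-flow `φ` that is nonzero off the support of an integral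
flow `σ` with values in `{0, 1, -1}`. The support of `σ` is a disjoint union of closed trails,
none of which meets the root `u`; the latter makes the induction work, as `σ` remains a flow when
the contraction of a block to the root is undone. -/
theorem exists_seymour_pair (s t : E → V) (A : Finset V) (F : Finset E) (u : V)
    (hF : HasEnds A F s t) (hc : EdgeConn 3 A F s t) (hu : u ∈ A) :
    ∃ (σ : E → ℤ) (φ : E → ZMod 3), bdry s t σ = 0 ∧ bdry s t φ = 0 ∧
      (∀ e, σ e = 0 ∨ σ e = 1 ∨ σ e = -1) ∧ (∀ e, e ∉ F → σ e = 0 ∧ φ e = 0) ∧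
      (∀ e ∈ F, σ e = 0 → φ e ≠ 0) ∧ ∀ e, s e = u ∨ t e = u → σ e = 0 := by
  induction hn : A.card using Nat.strong_induction_on generalizing A s t with
  | _ n ih =>
  subst hn
  by_cases hA : A = {u}
  · subst hA
    refine ⟨0, fun e => if e ∈ F then 1 else 0, by simp, ?_, by simp, ?_, ?_, by simp⟩
    · ext v
      rw [bdry_apply]
      refine sum_eq_zero fun e _ => ?_
      by_cases he : e ∈ F
      · have := hF e he
        simp only [mem_singleton] at this
        simp [he, this]
      · simp [he]
    · intro e he; simp [he]
    · intro e he; simp [he]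
  obtain ⟨B, hBA, huB, hB2, e₁, h₁F, e₂, h₂F, hne, x, hx, y, hy, h₁, h₂⟩ :=
    exists_leaf_block hF hc hu hA
  obtain ⟨C, hCF, hC, hyC⟩ := exists_closed_trail (fun e he => (mem_filter.1 he).2) hB2 hx hy
  have hCB : ∀ e ∈ C, e ∈ F ∧ s e ∈ B ∧ t e ∈ B := fun e he => mem_filter.1 (hCF he)
  let B₀ : Finset V := B.filter (OnTrail s t x C)
  have huB₀ : u ∉ B₀ := fun h => huB (mem_filter.1 h).1
  have hxB₀ : x ∈ B₀ := mem_filter.2 ⟨hx, Or.inl rfl⟩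
  have hyB₀ : y ∈ B₀ := mem_filter.2 ⟨hy, hyC⟩
  have hCB₀ : ∀ e ∈ C, s e ∈ B₀ ∧ t e ∈ B₀ := fun e he =>
    ⟨mem_filter.2 ⟨(hCB e he).2.1, Or.inr ⟨e, he, Or.inl rfl⟩⟩,
      mem_filter.2 ⟨(hCB e he).2.2, Or.inr ⟨e, he, Or.inr rfl⟩⟩⟩
  let r : V → V := fun v => if v ∈ B₀ then u else v
  have hr1 : ∀ v ∈ B₀, r v = u := fun v hv => if_pos hv
  have hr0 : ∀ v, v ∉ B₀ → r v = v := fun v hv => if_neg hv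
  have hru : r u = u := hr0 u huB₀
  have hru_iff : ∀ v, r v = u ↔ v ∈ insert u B₀ := by
    intro v
    by_cases hv : v ∈ B₀
    · simp [hr1 v hv, hv]
    · simp [hr0 v hv, hv]
  have hcard : (A.image r).card < A.card := by
    refine card_lt_card ((ssubset_iff_of_subset ?_).2 ⟨x, hBA hx, ?_⟩)
    · intro v hv
      obtain ⟨w, hw, rfl⟩ := mem_image.1 hv
      by_cases h : w ∈ B₀
      · rwa [hr1 w h]
      · rwa [hr0 w h]
    · intro h
      obtain ⟨w, hw, h⟩ := mem_image.1 h
      by_cases hw' : w ∈ B₀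
      · rw [hr1 w hw'] at h
        exact huB (h ▸ hx)
      · rw [hr0 w hw'] at h
        exact hw' (h ▸ hxB₀)
  obtain ⟨σ', φ', hσ', hφ', hval, h0, hnz, hroot⟩ := ih _ hcard (r ∘ s) (r ∘ t) (A.image r)
    (hF.image r) (hc.image r) (mem_image.2 ⟨u, hu, hru⟩) rfl
  obtain ⟨τ, hτ1, hτ0, hτ⟩ := hC.exists_flow
  rw [sub_self] at hτ
  -- The flow `σ'` avoids the contracted vertex, so it is also a flow in the original graph.
  have hσ'0 : ∀ e, s e ∈ insert u B₀ ∨ t e ∈ insert u B₀ → σ' e = 0 := fun e he =>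
    hroot e (by simpa only [Function.comp, hru_iff] using he)
  have hσ'b : bdry s t σ' = 0 := by
    ext v
    have := congrFun hσ' v
    rw [← this]
    simp only [bdry_apply, Function.comp]
    refine sum_congr rfl fun e _ => ?_
    by_cases hs : s e ∈ insert u B₀
    · simp [hσ'0 e (Or.inl hs)]
    by_cases ht : t e ∈ insert u B₀
    · simp [hσ'0 e (Or.inr ht)]
    simp only [hr0 _ fun h => hs (mem_insert_of_mem h), hr0 _ fun h => ht (mem_insert_of_mem h)]
  -- An edge between `B₀` and `u` contributes its value, up to sign, to the boundary on `B₀`.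
  have hsingle : ∀ e z, z ∈ B₀ → Joins s t e z u → ∃ ε : ZMod 3, (ε = 1 ∨ ε = -1) ∧
      ∀ a : ZMod 3, ∑ v ∈ B₀, bdry s t (Pi.single e a) v = ε * a := by
    rintro e z hz (⟨rfl, hu'⟩ | ⟨hu', rfl⟩)
    · refine ⟨1, Or.inl rfl, fun a => ?_⟩
      rw [bdry_single, hu']
      simp [sum_sub_distrib, hz, huB₀]
    · refine ⟨-1, Or.inr rfl, fun a => ?_⟩
      rw [bdry_single, hu']
      simp [sum_sub_distrib, hz, huB₀]
  obtain ⟨ε₁, hε₁, hs₁⟩ := hsingle e₁ x hxB₀ h₁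
  obtain ⟨ε₂, hε₂, hs₂⟩ := hsingle e₂ y hyB₀ h₂
  obtain ⟨a₁, a₂, ha₁, ha₂, hbal⟩ := zmod_three_balance (∑ v ∈ B₀, bdry s t φ' v)
    (φ' e₁) (φ' e₂) ε₁ ε₂ hε₁ hε₂
  let φ'' : E → ZMod 3 := φ' + Pi.single e₁ a₁ + Pi.single e₂ a₂
  have hφ''B : ∑ v ∈ B₀, bdry s t φ'' v = 0 := by
    simp only [φ'', map_add, Pi.add_apply, sum_add_distrib, hs₁, hs₂]
    exact hbal
  have hloop : ∀ e z a, z ∈ B₀ → Joins s t e z u →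
      bdry (r ∘ s) (r ∘ t) (Pi.single e a : E → ZMod 3) = 0 := by
    rintro e z a hz (⟨rfl, hu'⟩ | ⟨hu', rfl⟩) <;>
      simp [bdry_single, hu', hru, hr1 _ hz]
  have hφ''r : bdry (r ∘ s) (r ∘ t) φ'' = 0 := by
    simp only [φ'', map_add, hφ', hloop e₁ x a₁ hxB₀ h₁, hloop e₂ y a₂ hyB₀ h₂, add_zero]
  have hφ''u : bdry s t φ'' u = 0 := by
    have h := bdry_comp r s t φ'' u (insert u B₀) (fun e _ => hru_iff _) (fun e _ => hru_iff _)
    rwa [hφ''r, sum_insert huB₀, hφ''B, add_zero, Pi.zero_apply, eq_comm] at h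
  have hφ''v : ∀ v, v ∉ B₀ → bdry s t φ'' v = 0 := by
    intro v hv
    by_cases hvu : v = u
    · rw [hvu, hφ''u]
    have hiff : ∀ w, r w = v ↔ w ∈ ({v} : Finset V) := by
      intro w
      rw [mem_singleton]
      by_cases hw : w ∈ B₀
      · rw [hr1 w hw]
        exact ⟨fun h => absurd h.symm hvu, fun h => absurd (h ▸ hw) hv⟩
      · rw [hr0 w hw]
    have h := bdry_comp r s t φ'' v {v} (fun e _ => hiff _) (fun e _ => hiff _)
    rwa [hφ''r, sum_singleton, Pi.zero_apply, eq_comm] at h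
  obtain ⟨ξ, hξ0, hξ⟩ := exists_bdry_eq_of_paths (s := s) (t := t) (C := C) (B := B₀) (x := x)
    (fun z hz => by
      obtain ⟨C₁, C₂, _, rfl, hC₁, _⟩ := hC.split (mem_filter.1 hz).2
      obtain ⟨ρ, _, hρ0, hρ⟩ := hC₁.exists_flow
      exact ⟨ρ, fun e he => hρ0 e fun h => he (mem_union_left _ h), hρ⟩)
    (-bdry s t φ'') (fun v hv => by simp [hφ''v v hv]) (by simp [hφ''B])
  have heC : ∀ e z, Joins s t e z u → e ∉ C := by
    rintro e z h he
    have := hCB e he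
    unfold Joins at h
    grind
  have hoff : ∀ e, e ∉ F → φ'' e = 0 := by
    intro e he
    have q1 : e ≠ e₁ := by rintro rfl; exact he h₁F
    have q2 : e ≠ e₂ := by rintro rfl; exact he h₂F
    simp [φ'', (h0 e he).2, q1, q2]
  refine ⟨σ' + τ, φ'' + ξ, ?_, ?_, ?_, ?_, ?_, ?_⟩
  · rw [map_add, hσ'b, hτ, add_zero]
  · rw [map_add, hξ, add_neg_cancel]
  · intro e
    by_cases he : e ∈ C
    · rw [Pi.add_apply, hσ'0 e (Or.inl (mem_insert_of_mem (hCB₀ e he).1)), zero_add]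
      exact Or.inr (hτ1 e he)
    · rw [Pi.add_apply, hτ0 e he, add_zero]
      exact hval e
  · intro e he
    have heC : e ∉ C := fun h => he (hCB e h).1
    simp [(h0 e he).1, hτ0 e heC, hoff e he, hξ0 e heC]
  · intro e he hσe
    have heC' : e ∉ C := by
      intro h
      rw [Pi.add_apply, hσ'0 e (Or.inl (mem_insert_of_mem (hCB₀ e h).1)), zero_add] at hσe
      have := hτ1 e h
      omega
    rw [Pi.add_apply, hτ0 e heC', add_zero] at hσe
    rw [Pi.add_apply, hξ0 e heC', add_zero]
    by_cases q1 : e = e₁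
    · subst q1
      simpa [φ'', hne] using ha₁
    by_cases q2 : e = e₂
    · subst q2
      simpa [φ'', hne.symm] using ha₂
    simpa [φ'', q1, q2] using hnz e he hσe
  · intro e he
    have heC' : e ∉ C := by
      intro h
      have := (hCB e h).2
      obtain h' | h' := he <;> rw [h'] at this
      exacts [huB this.1, huB this.2]
    rw [Pi.add_apply, hτ0 e heC', hσ'0 e ?_, add_zero]
    obtain h' | h' := he
    · exact Or.inl (by simp [h'])
    · exact Or.inr (by simp [h'])

end Seymour

section Counting

/-! ### Counting flows with given support -/

variable {V E Γ : Type*}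

/-- The degree sum bounds the number of edges that are not loops. -/
lemma mul_card_le_of_star {k : ℕ} {A : Finset V} {F : Finset E} {s t : E → V}
    (h : ∀ v ∈ A, k ≤ (cut F s t {v}).card) :
    k * A.card ≤ 2 * (F.filter fun e => s e ≠ t e).card := by
  have h2 : A.card * k ≤ ∑ v ∈ A, (cut F s t {v}).card := by
    simpa using card_nsmul_le_sum A _ k h
  have h3 : ∑ v ∈ A, (cut F s t {v}).card ≤ 2 * (F.filter fun e => s e ≠ t e).card := by
    simp only [cut, card_filter, Set.mem_singleton_iff]
    rw [sum_comm, mul_sum]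
    refine sum_le_sum fun e _ => ?_
    by_cases he : s e = t e
    · simp [he]
    · rw [← card_filter]
      refine (card_le_card (t := {s e, t e}) fun v hv => ?_).trans (by simp [he])
      have := (mem_filter.1 hv).2
      simp only [mem_insert, mem_singleton]
      by_contra! hv'
      exact this ⟨fun h => absurd h.symm hv'.1, fun h => absurd h.symm hv'.2⟩
  linarith [mul_comm k A.card]

lemma EdgeConn.mul_card_le {k : ℕ} {A : Finset V} {F : Finset E} {s t : E → V}
    (hc : EdgeConn k A F s t) (hA : 1 < A.card) :
    k * A.card ≤ 2 * (F.filter fun e => s e ≠ t e).card := by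
  refine mul_card_le_of_star fun v hv => ?_
  obtain ⟨w, hw, hwv⟩ := exists_mem_ne hA v
  exact hc {v} ⟨v, hv, rfl⟩ ⟨w, hw, hwv⟩

variable [Fintype E] [AddCommGroup Γ]

/-- The flows vanishing outside `T`. -/
noncomputable def flowsOn (T : Finset E) (s t : E → V) (Γ : Type*) [AddCommGroup Γ] [Fintype Γ] :
    Finset (E → Γ) :=
  univ.filter fun φ => bdry s t φ = 0 ∧ ∀ e, e ∉ T → φ e = 0

lemma mem_flowsOn [Fintype Γ] {T : Finset E} {s t : E → V} {φ : E → Γ} :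
    φ ∈ flowsOn T s t Γ ↔ bdry s t φ = 0 ∧ ∀ e, e ∉ T → φ e = 0 := by
  simp [flowsOn]

/-- The flows whose support is exactly `F`. -/
def nzFlows (F : Finset E) (s t : E → V) (Γ : Type*) [AddCommGroup Γ] : Set (E → Γ) :=
  {φ | bdry s t φ = 0 ∧ ∀ e, φ e ≠ 0 ↔ e ∈ F}

/-- The cycle space of `(A, T)` has dimension at least `|T| - |A| + 1`. Indeed, a function
supported in `T` is a flow once its boundary vanishes at all vertices but one. -/
lemma card_flowsOn [Fintype Γ] {A : Finset V} {T : Finset E} {s t : E → V}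
    (hT : HasEnds A T s t) (hA : A.Nonempty) :
    Fintype.card Γ ^ (T.card + 1) ≤ (flowsOn T s t Γ).card * Fintype.card Γ ^ A.card := by
  obtain ⟨a, ha⟩ := hA
  let ext : (T → Γ) → (E → Γ) := fun φ e => if h : e ∈ T then φ ⟨e, h⟩ else 0
  have hext_inj : Function.Injective ext := by
    intro φ ψ h
    funext e
    have := congrFun h e.1
    simpa [ext, e.2] using this
  have hext0 : ∀ φ e, e ∉ T → ext φ e = 0 := fun φ e he => dif_neg he
  let f : (T → Γ) → (↥(A.erase a) → Γ) := fun φ v => bdry s t (ext φ) v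
  -- Every fibre of `f` embeds into the space of flows, by subtracting a fixed member.
  have hfib : ∀ b ∈ (univ : Finset (↥(A.erase a) → Γ)),
      (univ.filter fun φ => f φ = b).card ≤ (flowsOn T s t Γ).card := by
    intro b _
    obtain h | ⟨φ₀, hφ₀⟩ := (univ.filter fun φ => f φ = b).eq_empty_or_nonempty
    · simp [h]
    refine card_le_card_of_injOn (fun φ => ext φ - ext φ₀) (fun φ hφ => ?_) ?_
    · have hφ := (mem_filter.1 (mem_coe.1 hφ)).2
      have hφ₀ := (mem_filter.1 hφ₀).2
      rw [mem_coe, mem_flowsOn]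
      have h0 : ∀ e, e ∉ T → (ext φ - ext φ₀) e = 0 := fun e he => by
        simp [hext0 _ e he]
      refine ⟨?_, h0⟩
      have hv : ∀ v ∈ A.erase a, bdry s t (ext φ - ext φ₀) v = 0 := by
        intro v hv
        have h1 := congrFun hφ ⟨v, hv⟩
        have h2 := congrFun hφ₀ ⟨v, hv⟩
        simp only [f] at h1 h2
        rw [map_sub, Pi.sub_apply, h1, h2, sub_self]
      ext v
      by_cases hvA : v ∈ A
      · by_cases hva : v = a
        · have hsum := sum_bdry_eq_zero hT h0
          rw [← add_sum_erase A _ ha, sum_eq_zero hv, add_zero] at hsum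
          rw [hva, hsum, Pi.zero_apply]
        · exact hv v (mem_erase.2 ⟨hva, hvA⟩)
      · exact bdry_eq_zero_of_notMem hT h0 hvA
    · intro φ _ ψ _ h
      exact hext_inj (sub_left_injective h)
  have h := card_le_mul_card_image (s := (univ : Finset (T → Γ))) (f := f) _
    fun b hb => hfib b (mem_univ b)
  have h' : (univ.image f).card ≤ Fintype.card Γ ^ (A.card - 1) := by
    refine (card_le_univ _).trans ?_
    rw [Fintype.card_fun, Fintype.card_coe, card_erase_of_mem ha]
  rw [card_univ, Fintype.card_fun, Fintype.card_coe] at h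
  have hpos : 0 < A.card := card_pos.2 ⟨a, ha⟩
  calc Fintype.card Γ ^ (T.card + 1) = Fintype.card Γ ^ T.card * Fintype.card Γ := pow_succ _ _
    _ ≤ (flowsOn T s t Γ).card * Fintype.card Γ ^ (A.card - 1) * Fintype.card Γ :=
        Nat.mul_le_mul_right _ (h.trans (Nat.mul_le_mul_left _ h'))
    _ = (flowsOn T s t Γ).card * Fintype.card Γ ^ A.card := by
        rw [mul_assoc, ← pow_succ, Nat.sub_add_cancel hpos]

lemma rpow_le_card_flowsOn [Fintype Γ] {A : Finset V} {T : Finset E} {s t : E → V}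
    (hT : HasEnds A T s t) (hA : A.Nonempty) :
    (Fintype.card Γ : ℝ) ^ ((T.card : ℝ) + 1 - A.card) ≤ (flowsOn T s t Γ).card := by
  have hpos : (0 : ℝ) < Fintype.card Γ := by exact_mod_cast Fintype.card_pos
  rw [Real.rpow_sub hpos, div_le_iff₀ (by positivity), Real.rpow_natCast]
  have h := card_flowsOn (Γ := Γ) hT hA
  have : (Fintype.card Γ : ℝ) ^ ((T.card : ℝ) + 1) = (Fintype.card Γ : ℝ) ^ (T.card + 1) := by
    rw [← Real.rpow_natCast]; push_cast; rfl
  rw [this]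
  exact_mod_cast h

end Counting

section SixFlows

variable {V E : Type*} [Fintype E]

/-! ### Nowhere-zero flows over `ℤ₂ × ℤ₃` -/

/-- Averaging over a family of `ℤ₃`-flows that is invariant under a flow `τ` without zeros on
`S`: each edge of `S` is a zero of exactly a third of the flows. -/
lemma three_mul_sum_card_zeros {s t : E → V} {S : Finset E} {τ : E → ZMod 3}
    (hτ : bdry s t τ = 0) (hτS : ∀ e, τ e ≠ 0 ↔ e ∈ S) (φ : E → ZMod 3) :
    3 * ∑ ψ ∈ flowsOn S s t (ZMod 3), (S.filter fun e => φ e + ψ e = 0).card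
      = (flowsOn S s t (ZMod 3)).card * S.card := by
  have hshift : ∀ c : ZMod 3,
      ∑ ψ ∈ flowsOn S s t (ZMod 3), (S.filter fun e => φ e + ψ e = 0).card =
      ∑ ψ ∈ flowsOn S s t (ZMod 3), (S.filter fun e => φ e + ψ e + c * τ e = 0).card := by
    intro c
    have hcτ : bdry s t (fun e => c * τ e) = 0 := by
      ext v
      have := bdry_map s t (AddMonoidHom.mulLeft c) τ v
      simp only [AddMonoidHom.coe_mulLeft, hτ, Pi.zero_apply, mul_zero] at this
      exact this
    have hcτ0 : ∀ e, e ∉ S → c * τ e = 0 := fun e he => by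
      rw [not_not.1 (mt (hτS e).1 he), mul_zero]
    symm
    refine sum_equiv (Equiv.addRight fun e => c * τ e) (fun ψ => ?_) fun ψ _ => ?_
    · simp only [mem_flowsOn, Equiv.coe_addRight, map_add, hcτ, add_zero, Pi.add_apply]
      refine and_congr_right fun _ => forall₂_congr fun e he => ?_
      rw [hcτ0 e he, add_zero]
    · refine congrArg card (filter_congr fun e _ => ?_)
      simp [add_assoc]
  have hone : ∀ a b : ZMod 3, b ≠ 0 → (univ.filter fun c : ZMod 3 => a + c * b = 0).card = 1 := by
    intro a b hb
    rw [card_eq_one]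
    refine ⟨-a / b, ?_⟩
    ext c
    have : Fact (Nat.Prime 3) := ⟨Nat.prime_three⟩
    simp only [mem_filter, mem_univ, true_and, mem_singleton, eq_div_iff hb]
    exact ⟨fun h => by linear_combination h, fun h => by rw [h]; ring⟩
  calc 3 * ∑ ψ ∈ flowsOn S s t (ZMod 3), (S.filter fun e => φ e + ψ e = 0).card
      = ∑ c : ZMod 3, ∑ ψ ∈ flowsOn S s t (ZMod 3),
          (S.filter fun e => φ e + ψ e = 0).card := by
        rw [sum_const, card_univ, ZMod.card, smul_eq_mul]
    _ = ∑ c : ZMod 3, ∑ ψ ∈ flowsOn S s t (ZMod 3),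
          (S.filter fun e => φ e + ψ e + c * τ e = 0).card :=
        sum_congr rfl fun c _ => hshift c
    _ = ∑ ψ ∈ flowsOn S s t (ZMod 3), ∑ e ∈ S, 1 := by
        rw [sum_comm]
        refine sum_congr rfl fun ψ _ => ?_
        simp only [card_filter]
        rw [sum_comm]
        refine sum_congr rfl fun e he => ?_
        rw [← card_filter]
        exact hone _ _ ((hτS e).2 he)
    _ = _ := by simp

/-- A convexity estimate: `2 ^ (-z)` is on average at least `2 ^ (-a)` for `a` the average
of `z`. -/
lemma card_mul_two_rpow_le_sum {ι : Type*} (K : Finset ι) (z : ι → ℝ) (a : ℝ)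
    (h : ∑ i ∈ K, z i = K.card * a) : (K.card : ℝ) * 2 ^ (-a) ≤ ∑ i ∈ K, (2 : ℝ) ^ (-z i) := by
  have h1 : ∀ i ∈ K, (2 : ℝ) ^ (-a) * (1 + (a - z i) * Real.log 2) ≤ 2 ^ (-z i) := by
    intro i _
    have : (2 : ℝ) ^ (-z i) = 2 ^ (-a) * 2 ^ (a - z i) := by
      rw [← Real.rpow_add two_pos]; ring_nf
    rw [this]
    refine mul_le_mul_of_nonneg_left ?_ (by positivity)
    rw [Real.rpow_def_of_pos two_pos, mul_comm (Real.log 2)]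
    linarith [Real.add_one_le_exp ((a - z i) * Real.log 2)]
  refine le_trans (le_of_eq ?_) (sum_le_sum h1)
  rw [← mul_sum, sum_add_distrib, ← sum_mul, sum_sub_distrib, h]
  simp [mul_comm]

/-- Given a `ℤ₂`-flow with support `S` and a `ℤ₃`-flow `φ` without zeros on `F \ S`, one may add
to `φ` any `ℤ₃`-flow `ψ` supported in `S`, and then to the `ℤ₂`-flow any `ℤ₂`-flow supported
where `φ + ψ` is nonzero. -/
lemma sum_card_flowsOn_le_ncard {s t : E → V} {F S : Finset E} {τ : E → ZMod 2}
    {φ : E → ZMod 3} (hSF : S ⊆ F) (hτ : bdry s t τ = 0) (hτS : ∀ e, τ e ≠ 0 ↔ e ∈ S)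
    (hφ : bdry s t φ = 0) (hφ0 : ∀ e, e ∉ F → φ e = 0) (hφS : ∀ e ∈ F, e ∉ S → φ e ≠ 0) :
    ∑ ψ ∈ flowsOn S s t (ZMod 3),
      (flowsOn (F.filter fun e => φ e + ψ e ≠ 0) s t (ZMod 2)).card
      ≤ (nzFlows F s t (ZMod 2 × ZMod 3)).ncard := by
  rw [← card_sigma, Set.ncard_eq_toFinset_card']
  refine card_le_card_of_injOn (fun p e => (τ e + p.2 e, φ e + p.1 e)) ?_ ?_
  · rintro ⟨ψ, η⟩ hp
    simp only [coe_sigma, Set.mem_sigma_iff, mem_coe, mem_flowsOn, mem_filter, not_and,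
      not_not] at hp
    obtain ⟨⟨hψ, hψ0⟩, hη, hη0⟩ := hp
    rw [mem_coe, Set.mem_toFinset]
    refine ⟨?_, fun e => ?_⟩
    · ext v
      · have := bdry_map s t (AddMonoidHom.fst (ZMod 2) (ZMod 3))
          (fun e => (τ e + η e, φ e + ψ e)) v
        rw [Pi.zero_apply, Prod.fst_zero]
        refine this.symm.trans ?_
        exact (congrFun (map_add (bdry s t) τ η) v).trans (by simp [hτ, hη])
      · have := bdry_map s t (AddMonoidHom.snd (ZMod 2) (ZMod 3))
          (fun e => (τ e + η e, φ e + ψ e)) v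
        rw [Pi.zero_apply, Prod.snd_zero]
        refine this.symm.trans ?_
        exact (congrFun (map_add (bdry s t) φ ψ) v).trans (by simp [hφ, hψ])
    · rw [Ne, Prod.mk_eq_zero, not_and_or]
      by_cases he : e ∈ F
      · simp only [he, iff_true]
        by_cases hz : φ e + ψ e = 0
        · left
          rw [hη0 e (fun _ => hz), add_zero, ← Ne, hτS]
          by_contra heS
          rw [hψ0 e heS, add_zero] at hz
          exact hφS e he heS hz
        · exact Or.inr hz
      · have heS : e ∉ S := fun h => he (hSF h)
        simp [he, hη0 e (fun h => absurd h he), not_not.1 (mt (hτS e).1 heS), hφ0 e he,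
          hψ0 e heS]
  · rintro ⟨ψ, η⟩ _ ⟨ψ', η'⟩ _ h
    have h1 : ψ = ψ' := funext fun e => by
      have := congrArg Prod.snd (congrFun h e)
      simpa using this
    have h2 : η = η' := funext fun e => by
      have := congrArg Prod.fst (congrFun h e)
      simpa using this
    rw [h1, h2]

/-- Seymour's pair of flows together with the averaging argument. -/
theorem EdgeConn.three_le_ncard_nzFlows {s t : E → V} {A : Finset V} {F : Finset E}
    (hF : HasEnds A F s t) (hA : A.Nonempty) (hc : EdgeConn 3 A F s t) :
    (2 : ℝ) ^ (((F.card : ℝ) - A.card) / 3) ≤ (nzFlows F s t (ZMod 2 × ZMod 3)).ncard := by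
  obtain ⟨u, hu⟩ := hA
  obtain ⟨σ, φ, hσ, hφ, hval, h0, hnz, _⟩ := exists_seymour_pair s t A F u hF hc hu
  let S : Finset E := univ.filter fun e => σ e ≠ 0
  have hSF : S ⊆ F := fun e he => by
    by_contra h
    exact (mem_filter.1 he).2 (h0 e h).1
  have hcast : ∀ k : ℕ, bdry s t (fun e => (σ e : ZMod k)) = 0 := by
    intro k
    ext v
    have := bdry_map s t (Int.castAddHom (ZMod k)) σ v
    simpa [hσ] using this
  have hS2 : ∀ e, (σ e : ZMod 2) ≠ 0 ↔ e ∈ S := by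
    intro e
    simp only [S, mem_filter, mem_univ, true_and]
    obtain h | h | h := hval e <;> rw [h] <;> decide
  have hS3 : ∀ e, (σ e : ZMod 3) ≠ 0 ↔ e ∈ S := by
    intro e
    simp only [S, mem_filter, mem_univ, true_and]
    obtain h | h | h := hval e <;> rw [h] <;> decide
  have hφS : ∀ e ∈ F, e ∉ S → φ e ≠ 0 := fun e he heS =>
    hnz e he (by simpa [S] using heS)
  have hN := sum_card_flowsOn_le_ncard hSF (hcast 2) hS2 hφ (fun e he => (h0 e he).2) hφS
  have havg := three_mul_sum_card_zeros (hcast 3) hS3 φ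
  have hHS : HasEnds A S s t := fun e he => hF e (hSF he)
  set K := flowsOn S s t (ZMod 3) with hK
  let z : (E → ZMod 3) → ℝ := fun ψ => ((S.filter fun e => φ e + ψ e = 0).card : ℝ)
  have hz : ∑ ψ ∈ K, z ψ = K.card * ((S.card : ℝ) / 3) := by
    have : (3 : ℝ) * ∑ ψ ∈ K, z ψ = K.card * S.card := by
      simp only [z]; exact_mod_cast havg
    linarith
  have hterm : ∀ ψ ∈ K, (2 : ℝ) ^ ((F.card : ℝ) + 1 - A.card) * 2 ^ (-z ψ) ≤
      ((flowsOn (F.filter fun e => φ e + ψ e ≠ 0) s t (ZMod 2)).card : ℝ) := by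
    intro ψ hψ
    have h1 := rpow_le_card_flowsOn (Γ := ZMod 2) (A := A)
      (T := F.filter fun e => φ e + ψ e ≠ 0) (s := s) (t := t)
      (fun e he => hF e (mem_filter.1 he).1) ⟨u, hu⟩
    have h2 : (F.filter fun e => φ e + ψ e ≠ 0).card
        + (S.filter fun e => φ e + ψ e = 0).card = F.card := by
      rw [add_comm, ← card_filter_add_card_filter_not (s := F) fun e => φ e + ψ e = 0]
      congr 2
      ext e
      simp only [mem_filter]
      refine and_congr_left fun he => ⟨fun h => hSF h, fun h => ?_⟩
      by_contra heS
      rw [(mem_flowsOn.1 hψ).2 e heS, add_zero] at he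
      exact hφS e h heS he
    refine le_trans (le_of_eq ?_) h1
    rw [← Real.rpow_add two_pos, ZMod.card, ← h2]
    push_cast
    congr 1
    ring
  have hsum : (2 : ℝ) ^ ((F.card : ℝ) + 1 - A.card) * (K.card * 2 ^ (-((S.card : ℝ) / 3))) ≤
      (nzFlows F s t (ZMod 2 × ZMod 3)).ncard := by
    calc _ ≤ (2 : ℝ) ^ ((F.card : ℝ) + 1 - A.card) * ∑ ψ ∈ K, (2 : ℝ) ^ (-z ψ) :=
          mul_le_mul_of_nonneg_left (card_mul_two_rpow_le_sum K z _ hz) (by positivity)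
      _ ≤ ∑ ψ ∈ K, ((flowsOn (F.filter fun e => φ e + ψ e ≠ 0) s t (ZMod 2)).card : ℝ) := by
          rw [mul_sum]; exact sum_le_sum hterm
      _ ≤ _ := by exact_mod_cast hN
  -- A bound `2 ^ k ≤ |K|` suffices if `k` is large enough.
  have hk : ∀ k : ℝ, (2 : ℝ) ^ k ≤ K.card →
      ((F.card : ℝ) - A.card) / 3 ≤ (F.card : ℝ) + 1 - A.card + (k - (S.card : ℝ) / 3) →
      (2 : ℝ) ^ (((F.card : ℝ) - A.card) / 3) ≤ (nzFlows F s t (ZMod 2 × ZMod 3)).ncard := by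
    intro k h1 h2
    calc (2 : ℝ) ^ (((F.card : ℝ) - A.card) / 3)
        ≤ 2 ^ ((F.card : ℝ) + 1 - A.card + (k - (S.card : ℝ) / 3)) :=
          Real.rpow_le_rpow_of_exponent_le one_le_two h2
      _ = (2 : ℝ) ^ ((F.card : ℝ) + 1 - A.card) * (2 ^ k * 2 ^ (-((S.card : ℝ) / 3))) := by
          rw [sub_eq_add_neg k, Real.rpow_add two_pos, Real.rpow_add two_pos]
      _ ≤ (2 : ℝ) ^ ((F.card : ℝ) + 1 - A.card) * (K.card * 2 ^ (-((S.card : ℝ) / 3))) := by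
          gcongr
      _ ≤ _ := hsum
  have hdeg : A.card = 1 ∨ (3 : ℝ) * A.card ≤ 2 * F.card := by
    have hpos := card_pos.2 ⟨u, hu⟩
    by_cases h : A.card = 1
    · exact Or.inl h
    · right
      have h1 := hc.mul_card_le (by omega)
      have h2 := card_filter_le F fun e => s e ≠ t e
      have : 3 * A.card ≤ 2 * F.card := by omega
      exact_mod_cast this
  have hdeg' : (A.card : ℝ) ≤ 2 * F.card / 3 + 1 := by
    obtain h | h := hdeg
    · rw [h]; push_cast; linarith [Nat.cast_nonneg (α := ℝ) F.card]
    · linarith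
  have hKne : 0 < K.card := card_pos.2 ⟨0, mem_flowsOn.2 ⟨map_zero _, fun _ _ => rfl⟩⟩
  by_cases hSA : (S.card : ℝ) + 1 - A.card ≤ 0
  · refine hk 0 (by rw [Real.rpow_zero]; exact_mod_cast hKne) ?_
    linarith
  · refine hk ((S.card : ℝ) + 1 - A.card) ?_ ?_
    · refine le_trans ?_ (rpow_le_card_flowsOn (Γ := ZMod 3) hHS ⟨u, hu⟩)
      rw [ZMod.card]
      exact Real.rpow_le_rpow (by norm_num) (by norm_num) (by linarith)
    · linarith

/-- Contracting an edge `e` of a 2-edge-cut does not increase the number of nowhere-zero flows: a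
nowhere-zero flow after the contraction extends to `e`, and its value there is, up to sign, the
value on the other edge of the cut. -/
lemma ncard_nzFlows_contract_le {Γ : Type*} [AddCommGroup Γ] [Finite Γ] {s t : E → V}
    {A : Finset V} {F : Finset E} (hF : HasEnds A F s t) {X : Set V} {e f : E} (hef : e ≠ f)
    (hX : cut F s t X = {e, f}) :
    (nzFlows (F.erase e) ((fun v => if v = t e then s e else v) ∘ s)
      ((fun v => if v = t e then s e else v) ∘ t) Γ).ncard ≤ (nzFlows F s t Γ).ncard := by
  set r : V → V := fun v => if v = t e then s e else v with hr
  have he : e ∈ F ∧ ¬ (s e ∈ X ↔ t e ∈ X) := by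
    have : e ∈ cut F s t X := by simp [hX]
    exact mem_filter.1 this
  have hf : f ∈ F ∧ ¬ (s f ∈ X ↔ t f ∈ X) := by
    have : f ∈ cut F s t X := by simp [hX]
    exact mem_filter.1 this
  have hst : s e ≠ t e := fun h => he.2 (by rw [h])
  refine (Set.ncard_le_ncard (t := (fun φ => Function.update φ e 0) '' nzFlows F s t Γ)
    (fun φ hφ => ?_) (Set.toFinite _)).trans (Set.ncard_image_le (Set.toFinite _))
  obtain ⟨hφ, hnz⟩ := hφ
  have hφe : φ e = 0 := by
    by_contra h
    exact notMem_erase e F ((hnz e).1 h)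
  have hφ0 : ∀ g, g ∉ F → φ g = 0 := fun g hg => by
    by_contra h
    exact hg (mem_of_mem_erase ((hnz g).1 h))
  have hsum : bdry s t φ (s e) + bdry s t φ (t e) = 0 := by
    have hiff : ∀ w, r w = s e ↔ w ∈ ({s e, t e} : Finset V) := by
      intro w
      simp only [hr, mem_insert, mem_singleton]
      split_ifs with h <;> simp [h]
    have h := bdry_comp r s t φ (s e) {s e, t e} (fun _ _ => hiff _) (fun _ _ => hiff _)
    rwa [hφ, sum_pair hst, Pi.zero_apply, eq_comm] at h
  have hother : ∀ v, v ≠ s e → v ≠ t e → bdry s t φ v = 0 := by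
    intro v h1 h2
    have hiff : ∀ w, r w = v ↔ w ∈ ({v} : Finset V) := by
      intro w
      simp only [hr, mem_singleton]
      split_ifs with h
      · rw [h]; exact ⟨fun h => absurd h.symm h1, fun h => absurd h.symm h2⟩
      · rfl
    have h := bdry_comp r s t φ v {v} (fun _ _ => hiff _) (fun _ _ => hiff _)
    rwa [hφ, sum_singleton, Pi.zero_apply, eq_comm] at h
  let ψ : E → Γ := φ + Pi.single e (-bdry s t φ (s e))
  have hψg : ∀ g, g ≠ e → ψ g = φ g := fun g hg => by simp [ψ, hg]
  have hψ : bdry s t ψ = 0 := by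
    ext v
    simp only [ψ, map_add, bdry_single, Pi.add_apply, Pi.sub_apply, Pi.zero_apply]
    by_cases h1 : v = s e
    · subst h1; simp [hst]
    by_cases h2 : v = t e
    · subst h2
      simp only [Pi.single_eq_of_ne h1, Pi.single_eq_same, zero_sub, neg_neg]
      rw [add_comm]; exact hsum
    · simp [h1, h2, hother v h1 h2]
  have hψ0 : ∀ g, g ∉ F → ψ g = 0 := fun g hg => by
    rw [hψg g (by rintro rfl; exact hg he.1), hφ0 g hg]
  have hψf : ψ f ≠ 0 := by
    rw [hψg f hef.symm]
    exact (hnz f).2 (mem_erase.2 ⟨hef.symm, hf.1⟩)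
  -- The net flow through the cut vanishes, and only `e` and `f` contribute to it.
  have hψe : ψ e ≠ 0 := by
    intro h
    have hs := sum_bdry s t ψ (A.filter (· ∈ X))
    rw [hψ] at hs
    simp only [Pi.zero_apply, sum_const_zero] at hs
    rw [sum_eq_single f] at hs
    · have := hF f hf.1
      simp only [mem_filter, this, true_and] at hs
      have h2 := hf.2
      obtain ⟨p1, p2⟩ | ⟨p1, p2⟩ : (s f ∈ X ∧ t f ∉ X) ∨ (s f ∉ X ∧ t f ∈ X) := by tauto
      · exact hψf (by simpa [p1, p2] using hs.symm)
      · exact hψf (by simpa [p1, p2] using hs.symm)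
    · intro g _ hgf
      by_cases hg : g ∈ F
      · by_cases hge : g = e
        · simp [hge, h]
        · have hgX : g ∉ cut F s t X := by simp [hX, hge, hgf]
          have hgX' : s g ∈ X ↔ t g ∈ X := by
            by_contra hcon
            exact hgX (mem_filter.2 ⟨hg, hcon⟩)
          simp only [mem_filter, hF g hg, true_and, hgX', sub_self]
      · simp [hψ0 g hg]
    · simp
  refine ⟨ψ, ⟨hψ, fun g => ?_⟩, ?_⟩
  · by_cases hge : g = e
    · subst hge; simp [hψe, he.1]
    · rw [hψg g hge, hnz, mem_erase]
      simp [hge]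
  · ext g
    by_cases hge : g = e
    · subst hge; simp [hφe]
    · simp [hge, hψg g hge]

/-- Induction on the number of vertices: edges of 2-edge-cuts are contracted until the graph is
3-edge-connected. -/
theorem EdgeConn.two_le_ncard_nzFlows {s t : E → V} {A : Finset V} {F : Finset E}
    (hF : HasEnds A F s t) (hA : A.Nonempty) (hc : EdgeConn 2 A F s t) :
    (2 : ℝ) ^ (((F.card : ℝ) - A.card) / 3) ≤ (nzFlows F s t (ZMod 2 × ZMod 3)).ncard := by
  induction hn : A.card using Nat.strong_induction_on generalizing A F s t with
  | _ n ih =>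
  subst hn
  by_cases h3 : EdgeConn 3 A F s t
  · exact h3.three_le_ncard_nzFlows hF hA
  simp only [EdgeConn, not_forall, not_le] at h3
  obtain ⟨X, ha, hb, h3⟩ := h3
  have h2 : (cut F s t X).card = 2 := le_antisymm (by omega) (hc X ha hb)
  obtain ⟨e, f, hef, hX⟩ := card_eq_two.1 h2
  have he : e ∈ F ∧ ¬ (s e ∈ X ↔ t e ∈ X) := by
    have : e ∈ cut F s t X := by simp [hX]
    exact mem_filter.1 this
  have hst : s e ≠ t e := fun h => he.2 (by rw [h])
  have hle := ncard_nzFlows_contract_le (Γ := ZMod 2 × ZMod 3) hF hef hX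
  set r : V → V := fun v => if v = t e then s e else v with hr
  have hrs : r (s e) = s e := if_neg hst
  have hrt : r (t e) = s e := if_pos rfl
  have hsub : A.image r ⊆ A.erase (t e) := by
    intro v hv
    obtain ⟨w, hw, rfl⟩ := mem_image.1 hv
    simp only [hr, mem_erase]
    split_ifs with h
    · exact ⟨hst, (hF e he.1).1⟩
    · exact ⟨h, hw⟩
  have hAe := card_erase_add_one (hF e he.1).2
  have hlt : (A.image r).card < A.card := by
    have := card_le_card hsub
    omega
  have hcut : EdgeConn 2 (A.image r) (F.erase e) (r ∘ s) (r ∘ t) := by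
    intro Y ha hb
    refine (hc.image r Y ha hb).trans (card_le_card fun g hg => ?_)
    obtain ⟨hgF, hg⟩ := mem_filter.1 hg
    refine mem_filter.2 ⟨mem_erase.2 ⟨?_, hgF⟩, hg⟩
    rintro rfl
    exact hg (by simp [hrs, hrt])
  have := ih _ hlt (fun g hg => hF.image r g (mem_of_mem_erase hg)) (hA.image r) hcut rfl
  refine le_trans ?_ (this.trans (by exact_mod_cast hle))
  refine Real.rpow_le_rpow_of_exponent_le one_le_two ?_
  have h4 : ((F.erase e).card : ℝ) + 1 = F.card := by exact_mod_cast card_erase_add_one he.1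
  have h5 : ((A.image r).card : ℝ) + 1 ≤ A.card := by exact_mod_cast hlt
  linarith

end SixFlows

section Packing

variable {V E : Type*}

/-! ### Two edge-disjoint connected spanning subgraphs -/

/-- The graph `(A, F)` has two edge-disjoint connected spanning subgraphs. -/
def Packs (A : Finset V) (F : Finset E) (s t : E → V) : Prop :=
  ∃ F₁ ⊆ F, ∃ F₂ ⊆ F, Disjoint F₁ F₂ ∧ EdgeConn 1 A F₁ s t ∧ EdgeConn 1 A F₂ s t

/-- The edges of `F` with both ends in `W`. -/
noncomputable def inner (F : Finset E) (s t : E → V) (W : Finset V) : Finset E :=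
  F.filter fun e => s e ∈ W ∧ t e ∈ W

lemma edgeConn_of_card_le_one {k : ℕ} {A : Finset V} {F : Finset E} {s t : E → V}
    (hA : A.card ≤ 1) : EdgeConn k A F s t := by
  rintro X ⟨a, ha, haX⟩ ⟨b, hb, hbX⟩
  rw [card_le_one.1 hA a ha b hb] at haX
  exact absurd haX hbX

lemma edgeConn_one_iff {A : Finset V} {F : Finset E} {s t : E → V} :
    EdgeConn 1 A F s t ↔ ∀ X : Set V, (∃ a ∈ A, a ∈ X) → (∃ b ∈ A, b ∉ X) →
      ∃ e ∈ F, ¬ (s e ∈ X ↔ t e ∈ X) := by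
  refine ⟨fun h X ha hb => exists_mem_cut h ha hb, fun h X ha hb => ?_⟩
  obtain ⟨e, he, heX⟩ := h X ha hb
  exact card_pos.2 ⟨e, mem_filter.2 ⟨he, heX⟩⟩

/-- The map that identifies the vertices of `W` with `w`. -/
noncomputable def collapse (W : Finset V) (w v : V) : V := if v ∈ W then w else v

lemma collapse_mem_iff {W : Finset V} {w : V} {X : Set V} (h : ∀ v ∈ W, v ∈ X ↔ w ∈ X) (v : V) :
    collapse W w v ∈ X ↔ v ∈ X := by
  unfold collapse
  split_ifs with hv
  · exact (h v hv).symm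
  · rfl

lemma image_collapse {A W : Finset V} {w : V} (hw : w ∈ W) (hWA : W ⊆ A) :
    A.image (collapse W w) = insert w (A \ W) := by
  ext v
  simp only [mem_image, collapse, mem_insert, mem_sdiff]
  constructor
  · rintro ⟨u, hu, rfl⟩
    split_ifs with h
    · exact Or.inl rfl
    · exact Or.inr ⟨hu, h⟩
  · rintro (rfl | ⟨hv, hvW⟩)
    · exact ⟨v, hWA hw, if_pos hw⟩
    · exact ⟨v, hv, if_neg hvW⟩

lemma card_image_collapse {A W : Finset V} {w : V} (hw : w ∈ W) (hWA : W ⊆ A) :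
    (A.image (collapse W w)).card + W.card = A.card + 1 := by
  rw [image_collapse hw hWA, card_insert_of_notMem (by simp [hw]), add_right_comm,
    card_sdiff_add_card_eq_card hWA]

lemma EdgeConn.of_collapse {A W : Finset V} {F F' : Finset E} {s t : E → V} {w : V} (hw : w ∈ W)
    (h : EdgeConn 1 W F s t)
    (h' : EdgeConn 1 (A.image (collapse W w)) F' (collapse W w ∘ s) (collapse W w ∘ t)) :
    EdgeConn 1 A (F ∪ F') s t := by
  rw [edgeConn_one_iff] at *
  rintro X ⟨a, ha, haX⟩ ⟨b, hb, hbX⟩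
  by_cases hX : ∀ v ∈ W, v ∈ X ↔ w ∈ X
  · obtain ⟨e, he, heX⟩ := h' X ⟨_, mem_image_of_mem _ ha, (collapse_mem_iff hX a).2 haX⟩
      ⟨_, mem_image_of_mem _ hb, fun hb' => hbX ((collapse_mem_iff hX b).1 hb')⟩
    simp only [Function.comp, collapse_mem_iff hX] at heX
    exact ⟨e, mem_union_right _ he, heX⟩
  · obtain ⟨e, he, heX⟩ := h X (by by_contra! hcon; exact hX fun v hv => by simp [hcon, hv, hw])
      (by by_contra! hcon; exact hX fun v hv => by simp [hcon, hv, hw])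
    exact ⟨e, mem_union_left _ he, heX⟩

lemma Packs.of_collapse {A W : Finset V} {F F₀ F₁ : Finset E} {s t : E → V} {w : V} (hw : w ∈ W)
    (h₀F : F₀ ⊆ F) (h₁F : F₁ ⊆ F) (hd : Disjoint F₀ F₁) (h : Packs W F₀ s t)
    (h' : Packs (A.image (collapse W w)) F₁ (collapse W w ∘ s) (collapse W w ∘ t)) :
    Packs A F s t := by
  obtain ⟨P₁, h1, P₂, h2, h12, c1, c2⟩ := h
  obtain ⟨Q₁, k1, Q₂, k2, k12, d1, d2⟩ := h'
  refine ⟨P₁ ∪ Q₁, union_subset (h1.trans h₀F) (k1.trans h₁F), P₂ ∪ Q₂,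
    union_subset (h2.trans h₀F) (k2.trans h₁F), ?_, c1.of_collapse hw d1, c2.of_collapse hw d2⟩
  simp only [disjoint_union_left, disjoint_union_right]
  exact ⟨⟨h12, (hd.mono h2 k1).symm⟩, hd.mono h1 k2, k12⟩

/-- Splitting two edges off at a vertex `v` of degree three: `e₁` and `e₂`, from `v` to `a₁`
and `a₂`, are replaced by one edge from `a₁` to `a₂`, which reuses the name `e₁`, and `v` and the
third edge are deleted. A packing of the resulting graph yields one of the original graph. -/
lemma Packs.of_splitting {A : Finset V} {F : Finset E} {s t : E → V} {v a₁ a₂ a₃ : V}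
    {e₁ e₂ e₃ : E} (h₁F : e₁ ∈ F) (h₂F : e₂ ∈ F) (h₃F : e₃ ∈ F) (h₁₃ : e₁ ≠ e₃)
    (h₂₃ : e₂ ≠ e₃) (j₁ : Joins s t e₁ v a₁) (j₂ : Joins s t e₂ v a₂)
    (j₃ : Joins s t e₃ v a₃) (m₁ : a₁ ∈ A.erase v) (m₃ : a₃ ∈ A.erase v)
    (h : Packs (A.erase v) (F \ {e₂, e₃}) (Function.update s e₁ a₁) (Function.update t e₁ a₂)) :
    Packs A F s t := by
  obtain ⟨P, hP, Q, hQ, hPQ, cP, cQ⟩ : ∃ P ⊆ F \ {e₂, e₃}, ∃ Q ⊆ F \ {e₂, e₃}, Disjoint P Q ∧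
      EdgeConn 1 (A.erase v) P (Function.update s e₁ a₁) (Function.update t e₁ a₂) ∧
      EdgeConn 1 (A.erase v) (Q.erase e₁) s t := by
    have key : ∀ Q : Finset E, e₁ ∉ Q →
        EdgeConn 1 (A.erase v) Q (Function.update s e₁ a₁) (Function.update t e₁ a₂) →
        EdgeConn 1 (A.erase v) (Q.erase e₁) s t := by
      intro Q h1 c
      rw [erase_eq_of_notMem h1]
      rw [edgeConn_one_iff] at *
      intro X ha hb
      obtain ⟨e, he, heX⟩ := c X ha hb
      have hne : e ≠ e₁ := by rintro rfl; exact h1 he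
      rw [Function.update_of_ne hne, Function.update_of_ne hne] at heX
      exact ⟨e, he, heX⟩
    obtain ⟨P, hP, Q, hQ, hPQ, cP, cQ⟩ := h
    by_cases h1 : e₁ ∈ Q
    · exact ⟨Q, hQ, P, hP, hPQ.symm, cQ, key P (disjoint_right.1 hPQ h1) cP⟩
    · exact ⟨P, hP, Q, hQ, hPQ, cP, key Q h1 cQ⟩
  have hsplit : ∀ (X : Set V) (b : V), b ∈ A.erase v → (v ∈ X ↔ b ∈ X) →
      (∃ a ∈ A, a ∈ X) → (∃ a ∈ A, a ∉ X) →
      (∃ a ∈ A.erase v, a ∈ X) ∧ ∃ a ∈ A.erase v, a ∉ X := by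
    rintro X b hb hvb ⟨a, ha, haX⟩ ⟨a', ha', haX'⟩
    constructor
    · by_cases h : a = v
      · exact ⟨b, hb, hvb.1 (h ▸ haX)⟩
      · exact ⟨a, mem_erase.2 ⟨h, ha⟩, haX⟩
    · by_cases h : a' = v
      · exact ⟨b, hb, fun hbX => haX' (h ▸ hvb.2 hbX)⟩
      · exact ⟨a', mem_erase.2 ⟨h, ha'⟩, haX'⟩
  have hcross : ∀ (X : Set V) (e : E) (b : V), Joins s t e v b →
      ((s e ∈ X ↔ t e ∈ X) ↔ (v ∈ X ↔ b ∈ X)) := by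
    rintro X e b (⟨rfl, rfl⟩ | ⟨rfl, rfl⟩)
    · rfl
    · exact iff_comm
  refine ⟨insert e₁ (insert e₂ P), ?_, insert e₃ (Q.erase e₁), ?_, ?_, ?_, ?_⟩
  · simp only [insert_subset_iff]
    exact ⟨h₁F, h₂F, hP.trans sdiff_subset⟩
  · simp only [insert_subset_iff]
    exact ⟨h₃F, (erase_subset _ _).trans (hQ.trans sdiff_subset)⟩
  · have hP2 : ∀ e ∈ P, e ∈ F \ {e₂, e₃} := fun e he => hP he
    have hQ2 : ∀ e ∈ Q, e ∈ F \ {e₂, e₃} := fun e he => hQ he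
    rw [disjoint_left] at *
    grind
  · rw [edgeConn_one_iff] at *
    intro X ha hb
    by_cases c1 : s e₁ ∈ X ↔ t e₁ ∈ X
    swap
    · exact ⟨e₁, by simp, c1⟩
    by_cases c2 : s e₂ ∈ X ↔ t e₂ ∈ X
    swap
    · exact ⟨e₂, by simp, c2⟩
    rw [hcross X _ _ j₁] at c1
    rw [hcross X _ _ j₂] at c2
    obtain ⟨ha', hb'⟩ := hsplit X a₁ m₁ c1 ha hb
    obtain ⟨e, he, heX⟩ := cP X ha' hb'
    have hne : e ≠ e₁ := by
      rintro rfl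
      simp only [Function.update_self] at heX
      exact heX (c1.symm.trans c2)
    rw [Function.update_of_ne hne, Function.update_of_ne hne] at heX
    exact ⟨e, by simp [he], heX⟩
  · rw [edgeConn_one_iff] at *
    intro X ha hb
    by_cases c3 : s e₃ ∈ X ↔ t e₃ ∈ X
    swap
    · exact ⟨e₃, by simp, c3⟩
    rw [hcross X _ _ j₃] at c3
    obtain ⟨ha', hb'⟩ := hsplit X a₃ m₃ c3 ha hb
    obtain ⟨e, he, heX⟩ := cQ X ha' hb'
    exact ⟨e, mem_insert_of_mem he, heX⟩

/-- A graph with `2 n - 2` edges all of whose subgraphs on `p ≥ 1` vertices have at most `2 p - 2`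
edges is the union of two edge-disjoint spanning trees. The induction contracts a proper subgraph
attaining the bound if there is one, and otherwise splits at a vertex of degree three. -/
theorem packs_of_tight {A : Finset V} {F : Finset E} {s t : E → V} (hF : HasEnds A F s t)
    (hcard : F.card + 2 = 2 * A.card)
    (hsparse : ∀ W ⊆ A, W.Nonempty → (inner F s t W).card + 2 ≤ 2 * W.card) :
    Packs A F s t := by
  induction hn : A.card using Nat.strong_induction_on generalizing A F s t with
  | _ n ih =>
  subst hn
  by_cases hA1 : A.card ≤ 1
  · exact ⟨∅, by simp, ∅, by simp, by simp, edgeConn_of_card_le_one hA1,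
      edgeConn_of_card_le_one hA1⟩
  have hloop : ∀ e ∈ F, s e ≠ t e := by
    intro e he heq
    have h := hsparse {s e} (by simpa using (hF e he).1) (by simp)
    have : 0 < (inner F s t {s e}).card := card_pos.2 ⟨e, by simp [inner, he, heq]⟩
    simp only [card_singleton] at h
    omega
  by_cases hW : ∃ W ⊆ A, W ≠ A ∧ 2 ≤ W.card ∧ (inner F s t W).card + 2 = 2 * W.card
  · obtain ⟨W, hWA, hne, hW2, htight⟩ := hW
    have hWlt := card_lt_card (hWA.ssubset_of_ne hne)
    obtain ⟨w, hw⟩ : W.Nonempty := card_pos.1 (by omega)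
    have hinF : inner F s t W ⊆ F := filter_subset _ _
    have himg := card_image_collapse hw hWA
    have hsd := card_sdiff_add_card_eq_card hinF
    refine Packs.of_collapse hw hinF sdiff_subset disjoint_sdiff
      (ih _ hWlt (fun e he => (mem_filter.1 he).2) htight ?_ rfl)
      (ih _ (by omega) (fun e he => hF.image _ e (mem_sdiff.1 he).1) (by omega) ?_ rfl)
    · intro W' hW' hne'
      refine le_trans ?_ (hsparse W' (hW'.trans hWA) hne')
      gcongr
      exact filter_subset_filter _ hinF
    · intro Y hYA hY
      by_cases hwY : w ∈ Y
      · have h1 := hsparse (Y ∪ W) (by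
          refine union_subset (hYA.trans ?_) hWA
          rw [image_collapse hw hWA]
          exact insert_subset (hWA hw) sdiff_subset) ⟨w, by simp [hw]⟩
        have hinter : Y ∩ W = {w} := by
          ext v
          simp only [mem_inter, mem_singleton]
          constructor
          · rintro ⟨hvY, hvW⟩
            have := hYA hvY
            rw [image_collapse hw hWA] at this
            simpa [hvW] using this
          · rintro rfl; exact ⟨hwY, hw⟩
        have h2 := card_union_add_card_inter Y W
        rw [hinter, card_singleton] at h2
        have hmem : ∀ v, collapse W w v ∈ Y ↔ v ∈ Y ∪ W := by
          intro v
          unfold collapse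
          split_ifs with h <;> simp [h, hwY]
        have h3 : (inner (F \ inner F s t W) (collapse W w ∘ s) (collapse W w ∘ t) Y).card
            + (inner F s t W).card ≤ (inner F s t (Y ∪ W)).card := by
          have hd : Disjoint (inner (F \ inner F s t W) (collapse W w ∘ s) (collapse W w ∘ t) Y)
              (inner F s t W) := disjoint_of_subset_left (filter_subset _ _) sdiff_disjoint
          rw [← card_union_of_disjoint hd]
          refine card_le_card fun e he => ?_
          obtain he | he := mem_union.1 he
          · obtain ⟨h, h'⟩ := mem_filter.1 he
            simp only [Function.comp, hmem] at h'
            exact mem_filter.2 ⟨(mem_sdiff.1 h).1, h'⟩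
          · obtain ⟨h, h'⟩ := mem_filter.1 he
            exact mem_filter.2 ⟨h, mem_union_right _ h'.1, mem_union_right _ h'.2⟩
        omega
      · have hYA' : Y ⊆ A := by
          refine hYA.trans ?_
          rw [image_collapse hw hWA]
          exact insert_subset (hWA hw) sdiff_subset
        refine le_trans ?_ (hsparse Y hYA' hY)
        gcongr
        intro e he
        obtain ⟨h, h'⟩ := mem_filter.1 he
        refine mem_filter.2 ⟨(mem_sdiff.1 h).1, ?_⟩
        have hmem : ∀ v, collapse W w v ∈ Y → v ∈ Y := by
          intro v
          unfold collapse
          split_ifs with h <;> simp [hwY]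
        exact ⟨hmem _ h'.1, hmem _ h'.2⟩
  have hstrict : ∀ W ⊆ A, W ≠ A → 2 ≤ W.card → (inner F s t W).card + 3 ≤ 2 * W.card := by
    intro W hWA hne hW2
    have h1 := hsparse W hWA (card_pos.1 (by omega))
    have h2 : (inner F s t W).card + 2 ≠ 2 * W.card := fun h => hW ⟨W, hWA, hne, hW2, h⟩
    omega
  obtain ⟨v, hvA, hv⟩ : ∃ v ∈ A, (cut F s t {v}).card ≤ 3 := by
    by_contra! hcon
    have h1 := mul_card_le_of_star (k := 4) hcon
    have h2 := card_filter_le F fun e => s e ≠ t e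
    omega
  have hAv := card_erase_add_one hvA
  have hstar : (inner F s t (A.erase v)).card + (cut F s t {v}).card = F.card := by
    rw [← card_union_of_disjoint]
    · congr 1
      ext e
      simp only [inner, cut, mem_union, mem_filter, mem_erase, Set.mem_singleton_iff]
      constructor
      · tauto
      · intro he
        have h1 := hF e he
        have h2 := hloop e he
        grind
    · rw [disjoint_left]
      intro e he he'
      simp only [inner, cut, mem_filter, mem_erase, Set.mem_singleton_iff] at he he'
      tauto
  have hjoin : ∀ e ∈ cut F s t {v}, e ∈ F ∧ ∃ a ∈ A.erase v, Joins s t e v a := by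
    intro e he
    simp only [cut, mem_filter, Set.mem_singleton_iff] at he
    have := hF e he.1
    refine ⟨he.1, ?_⟩
    unfold Joins
    grind
  by_cases hA2 : A.card = 2
  · have hA1' : (A.erase v).card ≤ 1 := by omega
    have h0 : (inner F s t (A.erase v)).card = 0 := by
      have := hsparse (A.erase v) (erase_subset _ _) (card_pos.1 (by omega))
      omega
    obtain ⟨e₁, h₁, e₂, h₂, h12⟩ := one_lt_card.1 (show 1 < (cut F s t {v}).card by omega)
    have hconn : ∀ e ∈ cut F s t {v}, EdgeConn 1 A {e} s t := by
      intro e he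
      obtain ⟨heF, b, hb, hj⟩ := hjoin e he
      rw [edgeConn_one_iff]
      rintro X ⟨a, ha, haX⟩ ⟨a', ha', haX'⟩
      refine ⟨e, by simp, ?_⟩
      have hall : ∀ c ∈ A, c = v ∨ c = b := by
        intro c hc
        by_cases hcv : c = v
        · exact Or.inl hcv
        · exact Or.inr (card_le_one.1 hA1' c (mem_erase.2 ⟨hcv, hc⟩) b hb)
      have q1 := hall a ha
      have q2 := hall a' ha'
      unfold Joins at hj
      grind
    exact ⟨{e₁}, by simpa using (hjoin e₁ h₁).1, {e₂}, by simpa using (hjoin e₂ h₂).1,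
      by simpa using h12, hconn e₁ h₁, hconn e₂ h₂⟩
  have hdeg : (cut F s t {v}).card = 3 := by
    have := hstrict (A.erase v) (erase_subset _ _)
      (fun h => notMem_erase v A (h.symm ▸ hvA)) (by omega)
    omega
  obtain ⟨e₁, e₂, e₃, h12, h13, h23, hcut⟩ := card_eq_three.1 hdeg
  obtain ⟨f1, a₁, m1, j1⟩ := hjoin e₁ (by simp [hcut])
  obtain ⟨f2, a₂, m2, j2⟩ := hjoin e₂ (by simp [hcut])
  obtain ⟨f3, a₃, m3, j3⟩ := hjoin e₃ (by simp [hcut])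
  have hreduce : ∀ (e₁ e₂ e₃ : E) (a₁ a₂ a₃ : V), e₁ ≠ e₂ → e₁ ≠ e₃ → e₂ ≠ e₃ →
      cut F s t {v} = {e₁, e₂, e₃} → e₁ ∈ F → e₂ ∈ F → e₃ ∈ F → Joins s t e₁ v a₁ →
      Joins s t e₂ v a₂ → Joins s t e₃ v a₃ → a₁ ∈ A.erase v → a₂ ∈ A.erase v →
      a₃ ∈ A.erase v → a₁ ≠ a₂ → Packs A F s t := by
    intro e₁ e₂ e₃ a₁ a₂ a₃ h12 h13 h23 hcut f1 f2 f3 j1 j2 j3 m1 m2 m3 h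
    refine Packs.of_splitting f1 f2 f3 h13 h23 j1 j2 j3 m1 m3 (ih _ (by omega) ?_ ?_ ?_ rfl)
    · intro e he
      obtain ⟨heF, he⟩ := mem_sdiff.1 he
      by_cases h1 : e = e₁
      · subst h1; simp only [Function.update_self]; exact ⟨m1, m2⟩
      · rw [Function.update_of_ne h1, Function.update_of_ne h1]
        have hec : e ∉ cut F s t {v} := by
          rw [hcut]; simp only [mem_insert, mem_singleton] at he ⊢; tauto
        have q1 := hF e heF
        have q2 := hloop e heF
        simp only [cut, mem_filter, Set.mem_singleton_iff, mem_erase] at hec ⊢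
        grind
    · have : (F \ {e₂, e₃}).card + ({e₂, e₃} : Finset E).card = F.card :=
        card_sdiff_add_card_eq_card (by simp [insert_subset_iff, f2, f3])
      rw [card_pair h23] at this
      omega
    · intro W hWA hWne
      have hWA' : W ⊆ A := hWA.trans (erase_subset _ _)
      have hne : W ≠ A := by rintro rfl; exact notMem_erase v _ (hWA hvA)
      have hsub : ∀ e ∈ inner (F \ {e₂, e₃}) (Function.update s e₁ a₁)
          (Function.update t e₁ a₂) W, e ≠ e₁ → e ∈ inner F s t W := by
        intro e he hne
        simp only [inner, mem_filter, Function.update_of_ne hne, mem_sdiff] at he ⊢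
        exact ⟨he.1.1, he.2⟩
      by_cases h1 : a₁ ∈ W ∧ a₂ ∈ W
      · have h2 : 2 ≤ W.card := one_lt_card.2 ⟨a₁, h1.1, a₂, h1.2, h⟩
        have h3 := hstrict W hWA' hne h2
        have h4 : (inner (F \ {e₂, e₃}) (Function.update s e₁ a₁)
            (Function.update t e₁ a₂) W).card ≤ (insert e₁ (inner F s t W)).card := by
          refine card_le_card fun e he => ?_
          by_cases hee : e = e₁
          · simp [hee]
          · exact mem_insert_of_mem (hsub e he hee)
        have h5 := card_insert_le e₁ (inner F s t W)
        omega
      · refine le_trans ?_ (hsparse W hWA' hWne)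
        gcongr
        intro e he
        refine hsub e he ?_
        rintro rfl
        have := (mem_filter.1 he).2
        simp only [Function.update_self] at this
        exact h1 this
  by_cases h : a₁ = a₂
  · by_cases h' : a₁ = a₃
    · -- Three parallel edges violate the bound for two vertices.
      have h1 := hsparse {v, a₁} (by
        simp [insert_subset_iff, hvA, mem_of_mem_erase m1]) (by simp)
      have h2 : cut F s t {v} ⊆ inner F s t {v, a₁} := by
        rw [hcut]
        intro e he
        subst h h'
        unfold Joins at j1 j2 j3
        simp only [inner, mem_filter, mem_insert, mem_singleton] at he ⊢
        grind
      have h3 := card_le_card h2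
      have h4 := card_le_two (a := v) (b := a₁)
      omega
    · exact hreduce e₁ e₃ e₂ a₁ a₃ a₂ h13 h12 h23.symm
        (by rw [hcut, pair_comm e₂ e₃]) f1 f3 f2 j1 j3 j2 m1 m3 m2 h'
  · exact hreduce e₁ e₂ e₃ a₁ a₂ a₃ h12 h13 h23 hcut f1 f2 f3 j1 j2 j3 m1 m2 m3 h

/-- A 4-edge-connected graph has two edge-disjoint connected spanning subgraphs: a minimal set
spanning enough edges induces a graph containing a packing, and is contracted. -/
theorem EdgeConn.packs {A : Finset V} {F : Finset E} {s t : E → V} (hF : HasEnds A F s t)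
    (hc : EdgeConn 4 A F s t) : Packs A F s t := by
  induction hn : A.card using Nat.strong_induction_on generalizing A F s t with
  | _ n ih =>
  subst hn
  by_cases hA1 : A.card ≤ 1
  · exact ⟨∅, by simp, ∅, by simp, by simp, edgeConn_of_card_le_one hA1,
      edgeConn_of_card_le_one hA1⟩
  let N : Finset E := F.filter fun e => s e ≠ t e
  let good : Finset (Finset V) := A.powerset.filter fun W =>
    2 ≤ W.card ∧ 2 * W.card ≤ (inner N s t W).card + 2
  have hgood : A ∈ good := by
    have h1 := hc.mul_card_le (by omega)
    have h2 : inner N s t A = N := filter_eq_self.2 fun e he => hF e (mem_filter.1 he).1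
    have h3 : N.card = (F.filter fun e => s e ≠ t e).card := rfl
    simp only [good, mem_filter, mem_powerset, subset_rfl, true_and, h2]
    omega
  obtain ⟨U, hU, hmin⟩ := exists_min_image good card ⟨A, hgood⟩
  obtain ⟨hUA, hU2, hUN⟩ : U ⊆ A ∧ 2 ≤ U.card ∧ 2 * U.card ≤ (inner N s t U).card + 2 := by
    simpa [good] using hU
  obtain ⟨F₀, hF₀, hF₀card⟩ := exists_subset_card_eq
    (show 2 * U.card - 2 ≤ (inner N s t U).card by omega)
  have hF₀' : ∀ e ∈ F₀, (e ∈ F ∧ s e ≠ t e) ∧ s e ∈ U ∧ t e ∈ U := by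
    intro e he
    obtain ⟨h1, h2⟩ := mem_filter.1 (hF₀ he)
    exact ⟨mem_filter.1 h1, h2⟩
  obtain ⟨u, hu⟩ : U.Nonempty := card_pos.1 (by omega)
  have himg := card_image_collapse hu hUA
  refine Packs.of_collapse (F₀ := F₀) (F₁ := F \ inner F s t U) hu (fun e he => (hF₀' e he).1.1)
    sdiff_subset ?_ (packs_of_tight (fun e he => (hF₀' e he).2) (by omega) ?_)
    (ih _ (by omega) (fun e he => hF.image _ e (mem_sdiff.1 he).1) ?_ rfl)
  · rw [disjoint_left]
    intro e he he'
    exact (mem_sdiff.1 he').2 (mem_filter.2 ⟨(hF₀' e he).1.1, (hF₀' e he).2⟩)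
  · intro W hWU hW
    by_cases hWeq : W = U
    · have := card_filter_le F₀ fun e => s e ∈ W ∧ t e ∈ W
      rw [inner, hWeq] at *
      omega
    by_cases hW1 : W.card ≤ 1
    · have h0 : inner F₀ s t W = ∅ := by
        refine filter_eq_empty_iff.2 fun e he h => (hF₀' e he).1.2 ?_
        exact card_le_one.1 hW1 _ h.1 _ h.2
      have := card_pos.2 hW
      rw [h0, card_empty]
      omega
    · have h1 : (inner F₀ s t W).card ≤ (inner N s t W).card :=
        card_le_card (filter_subset_filter _ (hF₀.trans (filter_subset _ _)))
      by_contra hcon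
      have hWg : W ∈ good := by
        simp only [good, mem_filter, mem_powerset]
        exact ⟨hWU.trans hUA, by omega, by omega⟩
      exact absurd (hmin W hWg) (not_le.2 (card_lt_card (hWU.ssubset_of_ne hWeq)))
  · intro X ha hb
    refine (hc.image _ X ha hb).trans (card_le_card fun e he => ?_)
    obtain ⟨heF, he⟩ := mem_filter.1 he
    refine mem_filter.2 ⟨mem_sdiff.2 ⟨heF, fun h => he ?_⟩, he⟩
    obtain ⟨_, h1, h2⟩ := mem_filter.1 h
    simp [collapse, h1, h2]

end Packing

section FourFlows

variable {V E : Type*} [Fintype E]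

/-! ### Nowhere-zero flows over `ℤ₂ × ℤ₂` -/

/-- If the complement of `P` is prescribed to carry the value one, a connected spanning `P` allows
completing it to a flow. -/
lemma EdgeConn.exists_flow_eq_one {s t : E → V} {A : Finset V} {F P : Finset E}
    (hF : HasEnds A F s t) (hPF : P ⊆ F) (hc : EdgeConn 1 A P s t) :
    ∃ φ : E → ZMod 2, bdry s t φ = 0 ∧ (∀ e, e ∉ F → φ e = 0) ∧ ∀ e ∈ F, e ∉ P → φ e = 1 := by
  let χ : E → ZMod 2 := fun e => if e ∈ F then 1 else 0
  have hχ : ∀ e, e ∉ F → χ e = 0 := fun e he => if_neg he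
  obtain ⟨ξ, hξ0, hξ⟩ := hc.exists_bdry_eq (-bdry s t χ)
    (fun v hv => by simp [bdry_eq_zero_of_notMem hF hχ hv])
    (by simp [sum_bdry_eq_zero hF hχ])
  refine ⟨χ + ξ, by rw [map_add, hξ, add_neg_cancel], fun e he => ?_, fun e he heP => ?_⟩
  · simp [hχ e he, hξ0 e fun h => he (hPF h)]
  · simp [χ, he, hξ0 e heP]

lemma bdry_prodMk {Γ Γ' : Type*} [AddCommGroup Γ] [AddCommGroup Γ'] (s t : E → V) (φ : E → Γ)
    (ψ : E → Γ') (v : V) :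
    bdry s t (fun e => (φ e, ψ e)) v = (bdry s t φ v, bdry s t ψ v) := by
  ext
  · exact (bdry_map s t (AddMonoidHom.fst Γ Γ') (fun e => (φ e, ψ e)) v).symm
  · exact (bdry_map s t (AddMonoidHom.snd Γ Γ') (fun e => (φ e, ψ e)) v).symm

theorem EdgeConn.nzFlows_nonempty {s t : E → V} {A : Finset V} {F : Finset E}
    (hF : HasEnds A F s t) (hc : EdgeConn 4 A F s t) :
    (nzFlows F s t (ZMod 2 × ZMod 2)).Nonempty := by
  obtain ⟨P, hP, Q, hQ, hPQ, cP, cQ⟩ := hc.packs hF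
  obtain ⟨φ, hφ, hφ0, hφ1⟩ := cP.exists_flow_eq_one hF hP
  obtain ⟨ψ, hψ, hψ0, hψ1⟩ := cQ.exists_flow_eq_one hF hQ
  refine ⟨fun e => (φ e, ψ e), ?_, fun e => ?_⟩
  · ext v : 1
    rw [bdry_prodMk, hφ, hψ]
    rfl
  · rw [Ne, Prod.mk_eq_zero, not_and_or]
    by_cases he : e ∈ F
    · simp only [he, iff_true]
      by_cases heP : e ∈ P
      · right; rw [hψ1 e he (disjoint_left.1 hPQ heP)]; exact one_ne_zero
      · left; rw [hφ1 e he heP]; exact one_ne_zero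
    · simp [he, hφ0 e he, hψ0 e he]

/-- The edges where a nowhere-zero flow differs from `c` form an even set, and any even subset of
it may be used to add multiples of `c`. -/
lemma card_flowsOn_le_ncard {s t : E → V} {F : Finset E} {φ : E → ZMod 2 × ZMod 2}
    (hφ : φ ∈ nzFlows F s t (ZMod 2 × ZMod 2)) {c : ZMod 2 × ZMod 2} (hc : c ≠ 0) :
    (flowsOn (F.filter fun e => φ e ≠ c) s t (ZMod 2)).card
      ≤ (nzFlows F s t (ZMod 2 × ZMod 2)).ncard := by
  obtain ⟨hφ, hnz⟩ := hφ
  rw [← Set.ncard_coe_finset]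
  refine Set.ncard_le_ncard_of_injOn
    (fun η : E → ZMod 2 => φ + fun e => (η e * c.1, η e * c.2)) ?_ ?_ (Set.toFinite _)
  · intro η hη
    obtain ⟨hη, hη0⟩ := mem_flowsOn.1 (mem_coe.1 hη)
    refine ⟨?_, fun e => ?_⟩
    · rw [map_add, hφ, zero_add]
      ext v : 1
      rw [bdry_prodMk]
      have h1 := bdry_map s t (AddMonoidHom.mulRight c.1) η v
      have h2 := bdry_map s t (AddMonoidHom.mulRight c.2) η v
      simp only [AddMonoidHom.mulRight_apply, hη, Pi.zero_apply, zero_mul] at h1 h2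
      rw [h1, h2]
      rfl
    · by_cases hec : e ∈ F ∧ φ e ≠ c
      · have key : ∀ p c : ZMod 2 × ZMod 2, ∀ x : ZMod 2, p ≠ 0 → p ≠ c →
            p + (x * c.1, x * c.2) ≠ 0 := by decide
        exact iff_of_true (key _ c _ ((hnz e).2 hec.1) hec.2) hec.1
      · rw [← hnz, Pi.add_apply, hη0 e (by simpa using hec), zero_mul, zero_mul,
          Prod.mk_zero_zero, add_zero]
  · intro η _ η' _ h
    funext e
    have h' := congrFun (add_left_cancel h) e
    have key : ∀ c : ZMod 2 × ZMod 2, ∀ x y : ZMod 2, c ≠ 0 →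
        (x * c.1, x * c.2) = (y * c.1, y * c.2) → x = y := by decide
    exact key c _ _ hc h'

theorem EdgeConn.four_le_ncard_nzFlows {s t : E → V} {A : Finset V} {F : Finset E}
    (hF : HasEnds A F s t) (hA : A.Nonempty) (hFne : F.Nonempty) (hc : EdgeConn 4 A F s t) :
    (2 : ℝ) ^ ((A.card : ℝ) / 3) ≤ (nzFlows F s t (ZMod 2 × ZMod 2)).ncard := by
  obtain ⟨φ, hφ⟩ := hc.nzFlows_nonempty hF
  let C : ZMod 2 × ZMod 2 → Finset E := fun c => F.filter fun e => φ e ≠ c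
  have hsum : (C (0, 1)).card + (C (1, 0)).card + (C (1, 1)).card = 2 * F.card := by
    have key : ∀ p : ZMod 2 × ZMod 2, p ≠ 0 → (if p ≠ (0, 1) then 1 else 0) +
        (if p ≠ (1, 0) then 1 else 0) + (if p ≠ (1, 1) then 1 else 0) = 2 := by decide
    simp only [C, card_filter]
    rw [← sum_add_distrib, ← sum_add_distrib, mul_comm, ← smul_eq_mul, ← sum_const]
    refine sum_congr rfl fun e he => ?_
    convert key (φ e) ((hφ.2 e).2 he)
  obtain ⟨c, hc0, hcard⟩ : ∃ c : ZMod 2 × ZMod 2, c ≠ 0 ∧ 2 * F.card ≤ 3 * (C c).card := by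
    by_contra! hcon
    have h1 := hcon (0, 1) (by decide)
    have h2 := hcon (1, 0) (by decide)
    have h3 := hcon (1, 1) (by decide)
    omega
  have hN : ((flowsOn (C c) s t (ZMod 2)).card : ℝ)
      ≤ (nzFlows F s t (ZMod 2 × ZMod 2)).ncard := by
    exact_mod_cast card_flowsOn_le_ncard hφ hc0
  refine le_trans ?_ ((rpow_le_card_flowsOn (Γ := ZMod 2) (A := A)
    (fun e he => hF e (mem_filter.1 he).1) hA).trans hN)
  rw [ZMod.card]
  refine Real.rpow_le_rpow_of_exponent_le (by norm_num) ?_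
  have hdim : 4 * A.card ≤ 3 * (C c).card + 3 := by
    have hApos := card_pos.2 hA
    have hFpos := card_pos.2 hFne
    by_cases h : A.card = 1
    · omega
    · have h1 := hc.mul_card_le (by omega)
      have h2 := card_filter_le F fun e => s e ≠ t e
      omega
  have hdim' : (4 : ℝ) * A.card ≤ 3 * (C c).card + 3 := by exact_mod_cast hdim
  linarith

end FourFlows

section Translation

variable {α β : Type*} {G : Graph α β}

/-! ### Translation to multigraphs -/

/-- The initial vertices of an orientation, as elements of the vertex set. -/
def srcV (D : G.Orientation) (e : G.edgeSet) : G.vertexSet := ⟨D.src e, (D.isLink e).left_mem⟩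

/-- The terminal vertices of an orientation, as elements of the vertex set. -/
def tgtV (D : G.Orientation) (e : G.edgeSet) : G.vertexSet := ⟨D.tgt e, (D.isLink e).right_mem⟩

lemma nowhereZeroFlows_eq [Fintype G.edgeSet] (D : G.Orientation) (Γ : Type*) [AddCommGroup Γ] :
    D.nowhereZeroFlows Γ = nzFlows univ (srcV D) (tgtV D) Γ := by
  ext φ
  refine and_congr ?_ (by simp)
  have key : ∀ v : G.vertexSet, bdry (srcV D) (tgtV D) φ v = 0 ↔
      ∑ e : G.edgeSet with D.src e = v, φ e = ∑ e : G.edgeSet with D.tgt e = v, φ e := by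
    intro v
    rw [bdry_apply, sum_sub_distrib, sub_eq_zero, sum_filter, sum_filter]
    simp only [srcV, tgtV, Subtype.ext_iff]
  constructor
  · intro h
    ext v
    exact (key v).2 (h v v.2)
  · intro h v hv
    exact (key ⟨v, hv⟩).1 (congrFun h ⟨v, hv⟩)

lemma vertexSet_nonempty {k : ℕ} (hk : 0 < k) (h : G.IsEdgeConnected k) :
    G.vertexSet.Nonempty := by
  simpa using (h ∅ (by simp) (by simpa using hk)).1

lemma edgeConn_of_isEdgeConnected [Fintype G.vertexSet] [Fintype G.edgeSet] (D : G.Orientation)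
    {k : ℕ} (h : G.IsEdgeConnected k) :
    EdgeConn k (univ : Finset G.vertexSet) univ (srcV D) (tgtV D) := by
  rintro X ⟨a, -, ha⟩ ⟨b, -, hb⟩
  by_contra! hlt
  have hcard : ((fun e : G.edgeSet => (e : β)) '' (cut univ (srcV D) (tgtV D) X : Set _)).encard
      < k := by
    refine (Set.encard_image_le _ _).trans_lt ?_
    rw [Set.encard_coe_eq_coe_finsetCard]
    exact_mod_cast hlt
  have hpath := (h _ (by rintro _ ⟨e, -, rfl⟩; exact e.2) hcard).2 a (by simp) b (by simp)
  have key : ∀ y, Relation.ReflTransGen (G.deleteEdges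
      ((fun e : G.edgeSet => (e : β)) '' (cut univ (srcV D) (tgtV D) X : Set _))).Adj (a : α) y →
      ∃ hy : y ∈ G.vertexSet, (⟨y, hy⟩ : G.vertexSet) ∈ X := by
    intro y hy
    induction hy with
    | refl => exact ⟨a.2, ha⟩
    | @tail y z _ hyz ih =>
      obtain ⟨hyV, hyX⟩ := ih
      obtain ⟨e, he⟩ := hyz
      rw [Graph.deleteEdges_isLink] at he
      obtain ⟨hl, hnot⟩ := he
      refine ⟨hl.right_mem, ?_⟩
      have hcut : srcV D ⟨e, hl.edge_mem⟩ ∈ X ↔ tgtV D ⟨e, hl.edge_mem⟩ ∈ X := by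
        by_contra hcon
        exact hnot ⟨⟨e, hl.edge_mem⟩, mem_coe.2 (mem_filter.2 ⟨mem_univ _, hcon⟩), rfl⟩
      obtain ⟨h1, h2⟩ | ⟨h1, h2⟩ := hl.eq_and_eq_or_eq_and_eq (D.isLink ⟨e, hl.edge_mem⟩)
      · have e1 : srcV D ⟨e, hl.edge_mem⟩ = ⟨y, hyV⟩ := Subtype.ext h1.symm
        have e2 : tgtV D ⟨e, hl.edge_mem⟩ = ⟨z, hl.right_mem⟩ := Subtype.ext h2.symm
        rw [← e2]; rw [← e1] at hyX; exact hcut.1 hyX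
      · have e1 : tgtV D ⟨e, hl.edge_mem⟩ = ⟨y, hyV⟩ := Subtype.ext h1.symm
        have e2 : srcV D ⟨e, hl.edge_mem⟩ = ⟨z, hl.right_mem⟩ := Subtype.ext h2.symm
        rw [← e2]; rw [← e1] at hyX; exact hcut.2 hyX
  obtain ⟨_, hbX⟩ := key b hpath
  exact hb hbX

lemma ncard_nzFlows_le_of_equiv {V E Γ Γ' : Type*} [Fintype E] [AddCommGroup Γ]
    [AddCommGroup Γ'] [Finite Γ'] (f : Γ ≃+ Γ') (F : Finset E) (s t : E → V) :
    (nzFlows F s t Γ).ncard ≤ (nzFlows F s t Γ').ncard := by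
  refine Set.ncard_le_ncard_of_injOn (fun φ e => f (φ e)) ?_ ?_ (Set.toFinite _)
  · rintro φ ⟨hφ, hnz⟩
    refine ⟨?_, fun e => by rw [← hnz]; simp⟩
    ext v
    have := bdry_map s t f.toAddMonoidHom φ v
    simpa [hφ] using this
  · intro φ _ ψ _ h
    funext e
    exact f.injective (congrFun h e)

end Translation

end FlowCount

open FlowCount

theorem mainTheorem1 {α β : Type*} (G : Graph α β) [Fintype G.vertexSet] [Fintype G.edgeSet]
    (D : G.Orientation) (n m : ℕ)
    (hn : Fintype.card G.vertexSet = n) (hm : Fintype.card G.edgeSet = m) :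
    (G.IsEdgeConnected 3 →
      (2 : ℝ) ^ (((m : ℝ) - (n : ℝ)) / 3) ≤ ((D.nowhereZeroFlows (ZMod 6)).ncard : ℝ)) ∧
    (G.IsEdgeConnected 2 →
      (2 : ℝ) ^ (((m : ℝ) - (n : ℝ)) / 3) ≤
        ((D.nowhereZeroFlows (ZMod 2 × ZMod 3)).ncard : ℝ)) ∧
    (G.IsEdgeConnected 4 → G.edgeSet.Nonempty →
      (2 : ℝ) ^ ((n : ℝ) / 3) ≤ ((D.nowhereZeroFlows (ZMod 2 × ZMod 2)).ncard : ℝ)) := by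
  have hends : HasEnds Finset.univ Finset.univ (srcV D) (tgtV D) := fun e _ => by simp
  have hne : ∀ k : ℕ, 0 < k → G.IsEdgeConnected k →
      (Finset.univ : Finset G.vertexSet).Nonempty := fun k hk h =>
    Finset.univ_nonempty_iff.2 (vertexSet_nonempty hk h).to_subtype
  have hnV : (Finset.univ : Finset G.vertexSet).card = n := hn
  have hmE : (Finset.univ : Finset G.edgeSet).card = m := hm
  have hsix : EdgeConn 2 Finset.univ Finset.univ (srcV D) (tgtV D) →
      (Finset.univ : Finset G.vertexSet).Nonempty → (2 : ℝ) ^ (((m : ℝ) - (n : ℝ)) / 3) ≤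
        ((D.nowhereZeroFlows (ZMod 2 × ZMod 3)).ncard : ℝ) := by
    intro h h'
    rw [nowhereZeroFlows_eq, ← hnV, ← hmE]
    exact h.two_le_ncard_nzFlows hends h'
  refine ⟨fun h => ?_, fun h => ?_, fun h hE => ?_⟩
  · refine (hsix ((edgeConn_of_isEdgeConnected D h).mono (by norm_num) subset_rfl)
      (hne 3 (by norm_num) h)).trans ?_
    rw [nowhereZeroFlows_eq, nowhereZeroFlows_eq]
    -- By the Chinese remainder theorem the two groups are isomorphic.
    exact_mod_cast ncard_nzFlows_le_of_equiv
      (ZMod.chineseRemainder (m := 2) (n := 3) (by norm_num)).symm.toAddEquiv _ _ _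
  · exact hsix (edgeConn_of_isEdgeConnected D h) (hne 2 (by norm_num) h)
  · rw [nowhereZeroFlows_eq, ← hnV]
    exact (edgeConn_of_isEdgeConnected D h).four_le_ncard_nzFlows hends
      (hne 4 (by norm_num) h) (Finset.univ_nonempty_iff.2 hE.to_subtype)
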